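/- Let $\mathbb{T}^2=\mathbb{R}^2/\mathbb{Z}^2$, $e_k(x)=e^{2\pi i k\cdot x}$, and for $s\in\mathbb{R}$ let $H^{s}$ be the space of real distributions $u=\sum_{k\in\mathbb{Z}^2}\hat u_k e_k$ (i.e. $\hat u_{-k}=\overline{\hat u_k}$) with $\|u\|_{H^s}^2=\sum_k(1+|k|^2)^s|\hat u_k|^2<\infty$. For $\rho,\theta>0$ let $t_1<t_2<\dots$ be the jump times of a Poisson process of rate $\rho$, let $\sigma_i$ be i.i.d. uniform on $\{\pm1\}$ and $x_i$ i.i.d. uniform on $\mathbb{T}^2$, all independent, and set, for $M\in[0,\infty]$, $$\Xi_M^{\theta,\rho}=\sum_{i:\,t_i\le M}\sigma_i e^{-\theta t_i}\delta_{x_i},$$ a random variable in $H^{-1-\delta}$ for every $\delta>0$. Let $\eta$ be white noise on $\mathbb{T}^2$: the random element of $H^{-1-\delta}$ such that $(\langle\eta,h\rangle)_{h}$ is a centred Gaussian process with covariance $\langle h,h'\rangle_{L^2}$. Fix $\theta,\lambda,\delta>0$. Then: 1. The family of the laws of $N^{-1/2}\,\Xi_M^{\theta,N\lambda}$, $M\in[0,\infty]$,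 $N\in[1,\infty)$, is tight on $H^{-1-\delta}$. 2. For every fixed $N\ge1$, as $M\to\infty$, the law of $N^{-1/2}\,\Xi_M^{\theta,N\lambda}$ converges weakly on $H^{-1-\delta}$ to the law of $N^{-1/2}\,\Xi_\infty^{\theta,N\lambda}$; in particular, for $N=1$, $\Xi_M^{\theta,\lambda}\to\Xi_\infty^{\theta,\lambda}$ in law. 3. White noise $\eta$ exists on $H^{-1-\delta}$, and for every fixed $M\in[0,\infty]$, as $N\to\infty$, the law of $N^{-1/2}\,\Xi_M^{\theta,N\lambda}$ converges weakly on $H^{-1-\delta}$ to the law of $\sqrt{\frac{(1-e^{-2\theta M})\lambda}{2\theta}}\;\eta$, where $e^{-2\theta\cdot\infty}=0$. 4. Let $(X_i)$ be a family of random variables on one probability space $(\Omega,\mathcal{F},\mathbb{P})$ with $X_i\sim N_i^{-1/2}\,\Xi_{M_i}^{\theta,N_i\lambda}$, $M_i\in[0,\infty]$, $N_i\ge1$, indexed by a sequence or, more generally, by a set with a proper countably generated filter. If $X_i\to Y$ almost surely in $H^{-1-\delta}$ (along the filter), then for every $1\le p<\infty$ all $X_i$ and $Y$ belong to $L^p(\Omega;H^{-1-\delta})$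 and $X_i\to Y$ in $L^p(\Omega;H^{-1-\delta})$. -/

import Mathlib

open MeasureTheory ProbabilityTheory Filter Topology
open scoped NNReal ENNReal

noncomputable section

namespace TorusVortex

/-! ### Sobolev spaces of real distributions on the torus `ℝ² / ℤ²` -/

/-- The two-dimensional torus `ℝ² / ℤ²`. -/
abbrev Torus : Type := UnitAddTorus (Fin 2)

/-- The uniform probability measure on the torus. -/
def torusMeasure : Measure Torus := Measure.pi fun _ => AddCircle.haarAddCircle

/-- The weight `(1 + |k|²) ^ s`, where `|k|` is the Euclidean norm of `k ∈ ℤ²`. -/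
def weight (s : ℝ) (k : Fin 2 → ℤ) : ℝ := (1 + ∑ i, (k i : ℝ) ^ 2) ^ s

theorem base_pos (k : Fin 2 → ℤ) : 0 < 1 + ∑ i, (k i : ℝ) ^ 2 := by positivity

theorem weight_pos (s : ℝ) (k : Fin 2 → ℤ) : 0 < weight s k := Real.rpow_pos_of_pos (base_pos k) s

theorem weight_half_sq (s : ℝ) (k : Fin 2 → ℤ) : weight (s / 2) k ^ 2 = weight s k := by
  rw [weight, weight, ← Real.rpow_natCast, ← Real.rpow_mul (base_pos k).le]
  norm_num

/-- A family of complex numbers, weighted so that the `H^s` norm becomes the `ℓ²` norm. -/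
def weighted (s : ℝ) (u : (Fin 2 → ℤ) → ℂ) (k : Fin 2 → ℤ) : ℂ := weight (s / 2) k • u k

theorem norm_weighted_sq (s : ℝ) (u : (Fin 2 → ℤ) → ℂ) (k : Fin 2 → ℤ) :
    ‖weighted s u k‖ ^ 2 = weight s k * ‖u k‖ ^ 2 := by
  rw [weighted, norm_smul, mul_pow, Real.norm_of_nonneg (weight_pos _ k).le, weight_half_sq]

theorem memlp_weighted_iff (s : ℝ) (u : (Fin 2 → ℤ) → ℂ) :
    Memℓp (weighted s u) 2 ↔ Summable fun k => weight s k * ‖u k‖ ^ 2 := by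
  rw [memℓp_gen_iff (by norm_num)]
  simp only [ENNReal.toReal_ofNat, Real.rpow_ofNat, norm_weighted_sq]

theorem weighted_add (s : ℝ) (u v : (Fin 2 → ℤ) → ℂ) :
    weighted s (u + v) = weighted s u + weighted s v := by
  funext k; simp [weighted]

theorem weighted_smul (s c : ℝ) (u : (Fin 2 → ℤ) → ℂ) :
    weighted s (c • u) = c • weighted s u := by
  funext k; simp only [weighted, Pi.smul_apply]; rw [smul_comm]

/-- The families of Fourier coefficients of the elements of `H^s`: those with
`û (-k) = conj (û k)` (the distribution is real) and `∑ (1 + |k|²) ^ s |û k|² < ∞`. -/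
def coeffSubmodule (s : ℝ) : Submodule ℝ ((Fin 2 → ℤ) → ℂ) where
  carrier := {u | (∀ k, u (-k) = starRingEnd ℂ (u k)) ∧
    Summable fun k => weight s k * ‖u k‖ ^ 2}
  zero_mem' := by simp
  add_mem' := by
    rintro u v ⟨hu, hu'⟩ ⟨hv, hv'⟩
    refine ⟨fun k => by simp [hu k, hv k], ?_⟩
    rw [← memlp_weighted_iff] at *
    rw [weighted_add]
    exact hu'.add hv'
  smul_mem' := by
    rintro c u ⟨hu, hu'⟩
    refine ⟨fun k => by simp [hu k], ?_⟩
    rw [← memlp_weighted_iff] at *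
    rw [weighted_smul]
    exact hu'.const_smul c

/-- The real Sobolev space `H^s` of the torus, for any real order `s`. An element `u` is given by
its Fourier coefficients: it stands for the distribution `∑ û k e_k`, `e_k x = exp (2 π i k · x)`. -/
def Sobolev (s : ℝ) : Type := coeffSubmodule s

instance (s : ℝ) : AddCommGroup (Sobolev s) := inferInstanceAs (AddCommGroup (coeffSubmodule s))

instance (s : ℝ) : Module ℝ (Sobolev s) := inferInstanceAs (Module ℝ (coeffSubmodule s))

/-- The `k`-th Fourier coefficient of `u ∈ H^s`. -/
def Sobolev.coeff {s : ℝ} (u : Sobolev s) (k : Fin 2 → ℤ) : ℂ := u.1 k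

/-- The embedding of `H^s` into `ℓ²` by weighted Fourier coefficients. -/
def Sobolev.toLp (s : ℝ) : Sobolev s →ₗ[ℝ] lp (fun _ : Fin 2 → ℤ => ℂ) 2 where
  toFun u := ⟨weighted s u.coeff, (memlp_weighted_iff s _).2 u.2.2⟩
  map_add' u v := Subtype.ext (weighted_add s u.coeff v.coeff)
  map_smul' c u := Subtype.ext (weighted_smul s c u.coeff)

theorem Sobolev.toLp_injective (s : ℝ) : Function.Injective (Sobolev.toLp s) := by
  intro u v h
  refine Subtype.ext (funext fun k => ?_)
  have h' : weighted s u.coeff k = weighted s v.coeff k := congrFun (congrArg Subtype.val h) k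
  exact smul_right_injective ℂ (weight_pos (s / 2) k).ne' h'

/-- The norm of `H^s`, see `Sobolev.norm_sq`. -/
instance (s : ℝ) : NormedAddCommGroup (Sobolev s) :=
  NormedAddCommGroup.induced _ _ (Sobolev.toLp s) (Sobolev.toLp_injective s)

instance (s : ℝ) : NormedSpace ℝ (Sobolev s) := NormedSpace.induced ℝ _ _ (Sobolev.toLp s)

instance (s : ℝ) : MeasurableSpace (Sobolev s) := borel _

instance (s : ℝ) : BorelSpace (Sobolev s) := ⟨rfl⟩

theorem Sobolev.norm_sq {s : ℝ} (u : Sobolev s) :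
    ‖u‖ ^ 2 = ∑' k, weight s k * ‖u.coeff k‖ ^ 2 := by
  have h := lp.norm_rpow_eq_tsum (p := 2) (by norm_num) (Sobolev.toLp s u)
  simp only [ENNReal.toReal_ofNat, Real.rpow_ofNat] at h
  calc ‖u‖ ^ 2 = ‖Sobolev.toLp s u‖ ^ 2 := rfl
    _ = _ := h.trans (tsum_congr fun k => norm_weighted_sq s u.coeff k)

theorem Sobolev.isometry_toLp (s : ℝ) : Isometry (Sobolev.toLp s) := fun _ _ => rfl

instance (s : ℝ) : CompleteSpace (Sobolev s) := by
  rw [completeSpace_iff_isComplete_range (Sobolev.isometry_toLp s).isUniformInducing]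
  have key : Set.range (Sobolev.toLp s) =
      ⋂ k, {v : lp (fun _ : Fin 2 → ℤ => ℂ) 2 | v (-k) = starRingEnd ℂ (v k)} := by
    ext v
    simp only [Set.mem_range, Set.mem_iInter, Set.mem_ofPred_eq]
    have hneg : ∀ k : Fin 2 → ℤ, weight (s / 2) (-k) = weight (s / 2) k := by
      intro k; simp [weight]
    constructor
    · rintro ⟨u, rfl⟩ k
      change weighted s u.coeff (-k) = starRingEnd ℂ (weighted s u.coeff k)
      have := u.2.1 k
      simp only [weighted, Sobolev.coeff, hneg, this, Complex.real_smul, map_mul,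
        Complex.conj_ofReal]
    · intro hv
      have hw : weighted s (fun k => (weight (s / 2) k)⁻¹ • v k) = v := by
        funext k
        simp only [weighted]
        rw [smul_inv_smul₀ (weight_pos _ k).ne']
      refine ⟨⟨fun k => (weight (s / 2) k)⁻¹ • v k, fun k => ?_, ?_⟩, Subtype.ext hw⟩
      · simp only [hneg, hv k, Complex.real_smul, map_mul, Complex.conj_ofReal]
      · rw [← memlp_weighted_iff, hw]
        exact v.2
  rw [key]
  refine (isClosed_iInter fun k => isClosed_eq ?_ ?_).isComplete
  · exact (lp.evalCLM ℝ (fun _ : Fin 2 → ℤ => ℂ) 2 (-k)).continuous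
  · exact Complex.continuous_conj.comp (lp.evalCLM ℝ (fun _ : Fin 2 → ℤ => ℂ) 2 k).continuous

instance : SecondCountableTopology (lp (fun _ : Fin 2 → ℤ => ℂ) 2) := by
  classical
  have hsep : TopologicalSpace.IsSeparable
      (Set.range fun k : Fin 2 → ℤ => lp.single (E := fun _ : Fin 2 → ℤ => ℂ) 2 k (1 : ℂ)) :=
    (Set.countable_range _).isSeparable
  have h2 := (hsep.span (R := ℂ)).closure
  have : TopologicalSpace.SeparableSpace (lp (fun _ : Fin 2 → ℤ => ℂ) 2) := by
    rw [← TopologicalSpace.isSeparable_univ_iff]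
    refine h2.mono fun f _ => ?_
    refine mem_closure_of_tendsto (lp.hasSum_single (by norm_num) f) (Eventually.of_forall ?_)
    intro t
    refine Submodule.sum_mem _ fun k _ => ?_
    have : lp.single (E := fun _ : Fin 2 → ℤ => ℂ) 2 k (f k)
        = f k • lp.single (E := fun _ : Fin 2 → ℤ => ℂ) 2 k (1 : ℂ) := by
      rw [← lp.single_smul, smul_eq_mul, mul_one]
    rw [this]
    exact Submodule.smul_mem _ _ (Submodule.subset_span ⟨k, rfl⟩)
  exact UniformSpace.secondCountable_of_separable _

instance (s : ℝ) : SecondCountableTopology (Sobolev s) :=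
  (Sobolev.isometry_toLp s).isEmbedding.secondCountableTopology

/-- The duality coupling `⟨u, h⟩ = ∑ û k conj (ĥ k)`, which is real and converges absolutely for
`u ∈ H^s` and `h ∈ H^r` as soon as `r + s ≥ 0`. It extends the scalar product of `L²`. -/
def pairing {s r : ℝ} (u : Sobolev s) (h : Sobolev r) : ℝ :=
  ∑' k, (u.coeff k * starRingEnd ℂ (h.coeff k)).re

/-- The square of the `L²` norm of `h` (for `h` in some `H^r` with `r ≥ 0`). -/
def l2NormSq {r : ℝ} (h : Sobolev r) : ℝ := ∑' k, ‖h.coeff k‖ ^ 2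

/-- `η` is the law of white noise on the torus, as a probability measure on `H^(-1-δ)`: under `η`
the couplings `⟨u, h⟩` with test functions `h ∈ H^(1+δ)`, the dual space, are centred Gaussian with
variance `‖h‖²` in `L²`. Since they are linear in `h`, they are then jointly Gaussian with
covariance `⟨h, h'⟩` in `L²`. -/
def IsWhiteNoise (δ : ℝ) (η : ProbabilityMeasure (Sobolev (-1 - δ))) : Prop :=
  ∀ h : Sobolev (1 + δ),
    HasLaw (fun u => pairing u h) (gaussianReal 0 (l2NormSq h).toNNReal)
      (η : Measure (Sobolev (-1 - δ)))

/-! ### Dirac masses -/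

theorem summable_weight {δ : ℝ} (hδ : 0 < δ) : Summable (weight (-1 - δ)) := by
  refine Summable.of_norm_bounded_eventually
    (EisensteinSeries.summable_one_div_norm_rpow (k := 2 + 2 * δ) (by linarith)) ?_
  rw [Filter.eventually_cofinite]
  refine (Set.finite_singleton (0 : Fin 2 → ℤ)).subset fun k hk => ?_
  by_contra hk0
  refine hk ?_
  have hpos : 0 < ‖k‖ := norm_pos_iff.2 hk0
  have hle : ‖k‖ ^ 2 ≤ 1 + ∑ i, (k i : ℝ) ^ 2 := by
    obtain ⟨i, hi⟩ : ∃ i, ‖k i‖ = ‖k‖ := by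
      obtain ⟨i, -, hi⟩ := Finset.exists_mem_eq_sup Finset.univ Finset.univ_nonempty
        (fun i => ‖k i‖₊)
      exact ⟨i, by rw [Pi.norm_def, hi]; rfl⟩
    have h1 : ‖k‖ ^ 2 = (k i : ℝ) ^ 2 := by rw [← hi, Int.norm_eq_abs, sq_abs]
    have h2 := Finset.single_le_sum (f := fun j => (k j : ℝ) ^ 2) (fun j _ => sq_nonneg _)
      (Finset.mem_univ i)
    linarith
  rw [Real.norm_of_nonneg (weight_pos _ k).le, weight]
  calc (1 + ∑ i, (k i : ℝ) ^ 2) ^ (-1 - δ) ≤ (‖k‖ ^ 2) ^ (-1 - δ) :=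
        Real.rpow_le_rpow_of_nonpos (by positivity) hle (by linarith)
    _ = ‖k‖ ^ (-(2 + 2 * δ)) := by
        rw [← Real.rpow_natCast, ← Real.rpow_mul hpos.le]
        congr 1
        push_cast
        ring

theorem norm_mFourier_apply (k : Fin 2 → ℤ) (x : Torus) : ‖UnitAddTorus.mFourier k x‖ = 1 := by
  simp only [UnitAddTorus.mFourier, ContinuousMap.coe_mk, norm_prod, fourier_apply,
    Circle.norm_coe, Finset.prod_const_one]

/-- The Dirac mass at `x`, as an element of `H^(-1-δ)`: its Fourier coefficients are
`exp (-2 π i k · x)`. -/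
def diracMass {δ : ℝ} (hδ : 0 < δ) (x : Torus) : Sobolev (-1 - δ) :=
  ⟨fun k => UnitAddTorus.mFourier (-k) x,
    fun k => by rw [← UnitAddTorus.mFourier_neg],
    by simpa [norm_mFourier_apply] using summable_weight hδ⟩

theorem continuous_diracMass {δ : ℝ} (hδ : 0 < δ) : Continuous (diracMass hδ) := by
  rw [continuous_iff_continuousAt]
  intro x₀
  have hc : Continuous fun x : Torus => ‖diracMass hδ x - diracMass hδ x₀‖ ^ 2 := by
    simp only [Sobolev.norm_sq]
    have hcoeff : ∀ (k : Fin 2 → ℤ) (x : Torus), (diracMass hδ x - diracMass hδ x₀).coeff k =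
        UnitAddTorus.mFourier (-k) x - UnitAddTorus.mFourier (-k) x₀ := fun _ _ => rfl
    simp only [hcoeff]
    refine continuous_tsum (u := fun k => weight (-1 - δ) k * 2 ^ 2) (fun k => by fun_prop)
      ((summable_weight hδ).mul_right _) fun k x => ?_
    rw [Real.norm_of_nonneg (mul_nonneg (weight_pos _ k).le (sq_nonneg _))]
    have : ‖UnitAddTorus.mFourier (-k) x - UnitAddTorus.mFourier (-k) x₀‖ ≤ 2 := by
      refine (norm_sub_le _ _).trans ?_
      rw [norm_mFourier_apply, norm_mFourier_apply]
      norm_num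
    have h0 := (weight_pos (-1 - δ) k).le
    gcongr
  have h1 : Tendsto (fun x : Torus => ‖diracMass hδ x - diracMass hδ x₀‖ ^ 2) (𝓝 x₀) (𝓝 0) := by
    have := hc.tendsto x₀
    simpa using this
  have h2 : Tendsto (fun x : Torus => ‖diracMass hδ x - diracMass hδ x₀‖) (𝓝 x₀) (𝓝 0) := by
    have := h1.sqrt
    simpa [Real.sqrt_sq] using this
  exact tendsto_iff_norm_sub_tendsto_zero.2 h2

/-! ### The Poissonian random distribution -/

/-- The uniform probability measure on the signs `{1, -1}`. -/
def signMeasure : Measure ℝ := (2⁻¹ : ℝ≥0∞) • (Measure.dirac 1 + Measure.dirac (-1))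

/-- The law of a triple consisting of a waiting time, exponential with rate `ρ`, a uniform sign and
a uniform point of the torus, all independent. -/
def markMeasure (ρ : ℝ) : Measure (ℝ × ℝ × Torus) :=
  (expMeasure ρ).prod (signMeasure.prod torusMeasure)

/-- The law of an i.i.d. sequence of such triples. It encodes the jump times of a Poisson process
of rate `ρ` together with independent signs and positions. -/
def sampleMeasure (ρ : ℝ) : Measure (ℕ → ℝ × ℝ × Torus) :=
  Measure.infinitePi fun _ => markMeasure ρ

/-- The time of the `i`-th jump (counted from `0`): the sum of the waiting times up to it. -/
def jumpTime (z : ℕ → ℝ × ℝ × Torus) (i : ℕ) : ℝ := ∑ j ∈ Finset.range (i + 1), (z j).1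

/-- The `i`-th sign. -/
def jumpSign (z : ℕ → ℝ × ℝ × Torus) (i : ℕ) : ℝ := (z i).2.1

/-- The `i`-th position. -/
def jumpPos (z : ℕ → ℝ × ℝ × Torus) (i : ℕ) : Torus := (z i).2.2

open Classical in
/-- The random distribution `Ξ_M = ∑_{i : t_i ≤ M} σ_i exp (-θ t_i) δ_{x_i}` in `H^(-1-δ)`, for
`M ∈ [0, ∞]`. -/
def vortexSum {δ : ℝ} (hδ : 0 < δ) (θ : ℝ) (M : ℝ≥0∞) (z : ℕ → ℝ × ℝ × Torus) :
    Sobolev (-1 - δ) :=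
  ∑' i, if ENNReal.ofReal (jumpTime z i) ≤ M then
    (jumpSign z i * Real.exp (-θ * jumpTime z i)) • diracMass hδ (jumpPos z i) else 0

instance : IsProbabilityMeasure torusMeasure := by
  unfold torusMeasure; infer_instance

instance : IsProbabilityMeasure signMeasure := by
  refine ⟨?_⟩
  simp [signMeasure, ENNReal.inv_two_add_inv_two]

theorem isProbabilityMeasure_sampleMeasure {ρ : ℝ} (hρ : 0 < ρ) :
    IsProbabilityMeasure (sampleMeasure ρ) := by
  have := isProbabilityMeasure_expMeasure hρ
  unfold sampleMeasure markMeasure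
  infer_instance

theorem measurable_vortexSum {δ : ℝ} (hδ : 0 < δ) (θ : ℝ) (M : ℝ≥0∞) :
    Measurable (vortexSum hδ θ M) := by
  have ht : ∀ i, Measurable fun z : ℕ → ℝ × ℝ × Torus => jumpTime z i := by
    intro i; unfold jumpTime; fun_prop
  have hs : ∀ i, Measurable fun z : ℕ → ℝ × ℝ × Torus => jumpSign z i := by
    intro i; unfold jumpSign; fun_prop
  have hx : ∀ i, Measurable fun z : ℕ → ℝ × ℝ × Torus => jumpPos z i := by
    intro i; unfold jumpPos; fun_prop
  refine Measurable.tsum fun i => Measurable.ite ?_ ?_ measurable_const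
  · exact measurableSet_le (ht i).ennreal_ofReal measurable_const
  · exact ((hs i).mul ((ht i).const_mul (-θ)).exp).smul
      ((continuous_diracMass hδ).measurable.comp (hx i))

/-- The law on `H^(-1-δ)` of `N^(-1/2) Ξ_M`, where `Ξ_M` is built with decay rate `θ` from a
Poisson process of rate `N λ`. -/
def vortexLaw {δ : ℝ} (hδ : 0 < δ) (θ : ℝ) {lam : ℝ} (hlam : 0 < lam) (M : ℝ≥0∞)
    (N : Set.Ici (1 : ℝ)) : ProbabilityMeasure (Sobolev (-1 - δ)) :=
  ⟨(sampleMeasure (N * lam)).map fun z => (√(N : ℝ))⁻¹ • vortexSum hδ θ M z,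
    haveI := isProbabilityMeasure_sampleMeasure (mul_pos (zero_lt_one.trans_le N.2) hlam)
    Measure.isProbabilityMeasure_map
      ((measurable_vortexSum hδ θ M).const_smul (√(N : ℝ))⁻¹).aemeasurable⟩

/-- The law of `c • u` when `u` has law `η`. -/
def scaledLaw {s : ℝ} (c : ℝ) (η : ProbabilityMeasure (Sobolev s)) :
    ProbabilityMeasure (Sobolev s) :=
  η.map (f := fun u => c • u) (measurable_const_smul c).aemeasurable

/-- The variance `(1 - exp (-2 θ M)) lam / (2 θ)`, with `exp (-2 θ M) = 0` for `M = ∞`. -/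
def limitVariance (θ lam : ℝ) (M : ℝ≥0∞) : ℝ :=
  (1 - if M = ∞ then 0 else Real.exp (-2 * θ * M.toReal)) * lam / (2 * θ)

end TorusVortex

end

open TorusVortex

/-! The jumps form a Markov chain whose state is the current time together with the partial sum of
the series. Everything is read off two functions of this state, both corrected by the factor H(t) =
exp(ρ ∫_t^∞ (g - 1)) (`expTail`) for the jumps yet to come. H solves the renewal equation E[g(t + W)
H(t + W)] = H(t) for an exponential waiting time W, which makes these functions a martingale or a
supermartingale along the chain; at infinite time H becomes 1 and the partial sums become the random
distribution.

With g the characteristic function of a single jump coupled with h, the martingale H(t) exp(i⟨u, h⟩)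
gives the characteristic functional exp(ρ ∫_0^∞ (g - 1)) (`integral_cexp_pairing_vortexSum`). For
rate Nλ and amplitude N^(-1/2) only the second-order term of the cosine survives as N → ∞. By
Parseval it is a multiple of the squared L² norm of h, so the limit is Gaussian.

With g = cosh(κ exp(-θt)), the supermartingale H(t) cosh‖u‖ gives an exponential moment uniform in M
and N (`lintegral_cosh_vortexLaw_le`). It rests on the Hilbert space inequality cosh‖u+v‖ +
cosh‖u-v‖ ≤ 2 cosh‖u‖ cosh‖v‖, which absorbs the random signs.

The rest follows. Tightness: the moment bound holds in H^(-1-δ/2), which embeds compactly in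
H^(-1-δ). Limit in N: tightness, plus a characteristic functional that determines every cluster
point; white noise itself is obtained as a rescaled cluster point. Limit in M: the series converges
almost surely on one sample space. Convergence in L^p: uniform moments of all orders and Vitali's
theorem. -/

namespace TorusVortex

/-! ### Recursions driven by an i.i.d. sequence -/

section Markov

variable {α E : Type*}

/-- Prepend a term to a sequence. -/
def consSeq (a : α) (z : ℕ → α) : ℕ → α
  | 0 => a
  | n + 1 => z n

/-- The states of the recursion `e ↦ step e (z n)` started at `e`. -/
def markovState (step : E → α → E) (e : E) (z : ℕ → α) : ℕ → E
  | 0 => e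
  | n + 1 => step (markovState step e z n) (z n)

theorem markovState_consSeq (step : E → α → E) (e : E) (a : α) (z : ℕ → α) (n : ℕ) :
    markovState step e (consSeq a z) (n + 1) = markovState step (step e a) z n := by
  induction n with
  | zero => rfl
  | succ n ih => rw [markovState, ih]; rfl

variable [MeasurableSpace α] [MeasurableSpace E]

theorem measurable_consSeq : Measurable fun p : α × (ℕ → α) => consSeq p.1 p.2 := by
  refine measurable_pi_lambda _ fun n => ?_
  cases n with
  | zero => exact measurable_fst
  | succ n => exact (measurable_pi_apply n).comp measurable_snd

/-- This replaces the Markov property: the first mark can be split off and integrated separately,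
without filtrations or conditional expectations. -/
theorem map_consSeq_infinitePi (ν : Measure α) [IsProbabilityMeasure ν] :
    (ν.prod (Measure.infinitePi fun _ : ℕ => ν)).map (fun p => consSeq p.1 p.2) =
      Measure.infinitePi fun _ : ℕ => ν := by
  refine Measure.eq_infinitePi _ fun s t ht => ?_
  classical
  rw [Measure.map_apply measurable_consSeq (.pi s.countable_toSet fun i _ => ht i)]
  -- The constraints on the coordinates of index at least 1, reindexed from 0.
  set s' : Finset ℕ := s.preimage Nat.succ (Nat.succ_injective.injOn) with hs'
  have hpre : (fun p : α × (ℕ → α) => consSeq p.1 p.2) ⁻¹' Set.pi s t =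
      (if 0 ∈ s then t 0 else Set.univ) ×ˢ Set.pi s' (fun i => t (i + 1)) := by
    ext ⟨a, z⟩
    simp only [Set.mem_preimage, Set.mem_pi, Finset.mem_coe, Set.mem_prod, hs',
      Finset.mem_preimage]
    constructor
    · intro h
      refine ⟨?_, fun i hi => h (i + 1) hi⟩
      split_ifs with h0
      · exact h 0 h0
      · trivial
    · rintro ⟨h0, h1⟩ i hi
      cases i with
      | zero => rw [if_pos hi] at h0; exact h0
      | succ i => exact h1 i hi
  rw [hpre, Measure.prod_prod, Measure.infinitePi_pi _ fun i _ => ht (i + 1)]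
  have hprod : ∏ i ∈ s', ν (t (i + 1)) = ∏ i ∈ s.filter (· ≠ 0), ν (t i) := by
    refine Finset.prod_bij (fun i _ => i + 1) (fun i hi => ?_) (fun _ _ _ _ h => by omega)
      (fun i hi => ?_) fun _ _ => rfl
    · simpa [hs'] using hi
    · rw [Finset.mem_filter] at hi
      obtain ⟨j, rfl⟩ := Nat.exists_eq_succ_of_ne_zero hi.2
      exact ⟨j, by simpa [hs'] using hi.1, rfl⟩
  rw [hprod, Finset.filter_ne']
  by_cases h0 : 0 ∈ s
  · rw [if_pos h0, Finset.mul_prod_erase s (fun i => ν (t i)) h0]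
  · rw [if_neg h0, measure_univ, one_mul, Finset.erase_eq_of_notMem h0]

theorem measurable_markovState {step : E → α → E} (hstep : Measurable (Function.uncurry step))
    (n : ℕ) : Measurable fun p : E × (ℕ → α) => markovState step p.1 p.2 n := by
  induction n with
  | zero => exact measurable_fst
  | succ n ih => exact hstep.comp (ih.prodMk ((measurable_pi_apply n).comp measurable_snd))

/-- First-step analysis: the first mark moves the starting point, and induction handles the
remaining steps. It serves with `q < 1` for the decay of the jump times and with `q = 1` for the
supermartingale. -/
theorem lintegral_markovState_le (ν : Measure α) [IsProbabilityMeasure ν] {step : E → α → E}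
    (hstep : Measurable (Function.uncurry step)) {T : E → ℝ≥0∞} (hT : Measurable T) {q : ℝ≥0∞}
    (h : ∀ e, ∫⁻ a, T (step e a) ∂ν ≤ q * T e) (n : ℕ) (e : E) :
    ∫⁻ z, T (markovState step e z n) ∂(Measure.infinitePi fun _ : ℕ => ν) ≤ q ^ n * T e := by
  induction n generalizing e with
  | zero => simp [markovState]
  | succ n ih =>
    have hm : Measurable fun p : α × (ℕ → α) => T (markovState step (step e p.1) p.2 n) :=
      hT.comp ((measurable_markovState hstep n).comp
        ((hstep.comp (measurable_const.prodMk measurable_fst)).prodMk measurable_snd))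
    have hm' : Measurable fun z : ℕ → α => T (markovState step e z (n + 1)) :=
      hT.comp ((measurable_markovState hstep (n + 1)).comp measurable_prodMk_left)
    rw [← map_consSeq_infinitePi ν, lintegral_map hm' measurable_consSeq]
    simp only [markovState_consSeq]
    rw [lintegral_prod _ hm.aemeasurable]
    have hTs : Measurable fun a => T (step e a) := hT.comp (hstep.comp measurable_prodMk_left)
    calc _ ≤ ∫⁻ a, q ^ n * T (step e a) ∂ν := lintegral_mono fun a => ih _
      _ = q ^ n * ∫⁻ a, T (step e a) ∂ν := lintegral_const_mul _ hTs
      _ ≤ q ^ n * (q * T e) := by gcongr; exact h e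
      _ = q ^ (n + 1) * T e := by ring

theorem integral_markovState_eq (ν : Measure α) [IsProbabilityMeasure ν] {step : E → α → E}
    (hstep : Measurable (Function.uncurry step)) {T : E → ℂ} (hT : Measurable T) {B : ℝ}
    (hB : ∀ e, ‖T e‖ ≤ B) (h : ∀ e, ∫ a, T (step e a) ∂ν = T e) (n : ℕ) (e : E) :
    ∫ z, T (markovState step e z n) ∂(Measure.infinitePi fun _ : ℕ => ν) = T e := by
  induction n generalizing e with
  | zero => simp [markovState]
  | succ n ih =>
    have hm : Measurable fun p : α × (ℕ → α) => T (markovState step (step e p.1) p.2 n) :=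
      hT.comp ((measurable_markovState hstep n).comp
        ((hstep.comp (measurable_const.prodMk measurable_fst)).prodMk measurable_snd))
    have hm' : Measurable fun z : ℕ → α => T (markovState step e z (n + 1)) :=
      hT.comp ((measurable_markovState hstep (n + 1)).comp measurable_prodMk_left)
    rw [← map_consSeq_infinitePi ν, integral_map measurable_consSeq.aemeasurable
      hm'.aestronglyMeasurable]
    simp only [markovState_consSeq]
    rw [integral_prod _ (Integrable.of_bound hm.aestronglyMeasurable B (ae_of_all _ fun p => hB _))]
    simp only [ih, h]

end Markov

/-! ### Exponential waiting times -/

theorem expMeasure_eq {ρ : ℝ} : expMeasure ρ =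
    (volume.restrict (Set.Ici 0)).withDensity
      (fun w => ENNReal.ofReal (ρ * Real.exp (-(ρ * w)))) := by
  rw [← withDensity_indicator measurableSet_Ici]
  have : exponentialPDF ρ = (Set.Ici 0).indicator
      (fun w => ENNReal.ofReal (ρ * Real.exp (-(ρ * w)))) := by
    funext x
    rw [exponentialPDF_eq]
    by_cases hx : 0 ≤ x
    · rw [if_pos hx, Set.indicator_of_mem (Set.mem_Ici.2 hx)]
    · rw [if_neg hx, Set.indicator_of_notMem (by simpa using hx), ENNReal.ofReal_zero]
  rw [← this]
  rfl

theorem lintegral_exp_expMeasure {ρ θ : ℝ} (hρ : 0 < ρ) (hθ : 0 < θ) :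
    ∫⁻ w, ENNReal.ofReal (Real.exp (-θ * w)) ∂(expMeasure ρ) =
      ENNReal.ofReal (ρ / (ρ + θ)) := by
  have h1 := lintegral_exponentialPDF_eq_one (add_pos hρ hθ)
  have hd : expMeasure ρ = volume.withDensity (exponentialPDF ρ) := rfl
  have hm : Measurable (exponentialPDF ρ) := (measurable_exponentialPDFReal ρ).ennreal_ofReal
  have hm' : Measurable (exponentialPDF (ρ + θ)) :=
    (measurable_exponentialPDFReal _).ennreal_ofReal
  rw [hd, lintegral_withDensity_eq_lintegral_mul _ hm (by fun_prop)]
  -- Tilting the exponential density of rate ρ by exp(-θw) gives a multiple of the density of rate ρ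
  -- + θ.
  have : ∀ w, (exponentialPDF ρ * fun w => ENNReal.ofReal (Real.exp (-θ * w))) w =
      ENNReal.ofReal (ρ / (ρ + θ)) * exponentialPDF (ρ + θ) w := by
    intro w
    rw [Pi.mul_apply, exponentialPDF_eq, exponentialPDF_eq, ← ENNReal.ofReal_mul (by positivity)]
    split_ifs
    · rw [← ENNReal.ofReal_mul (by positivity)]
      congr 1
      rw [mul_assoc, ← Real.exp_add, ← mul_assoc, div_mul_cancel₀ _ (by positivity)]
      congr 2
      ring
    · simp
  rw [lintegral_congr this, lintegral_const_mul _ hm', h1, mul_one]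

/-- `exp (ρ ∫_s^∞ (g - 1))`: for nonnegative `g`, the expectation of the product of the values of
`g` at the points after `s` of a Poisson process of rate `ρ`. -/
noncomputable def expTail (ρ : ℝ) (g : ℝ → ℝ) (s : ℝ) : ℝ :=
  Real.exp (ρ * ∫ t in Set.Ioi s, (g t - 1))

section expTail

variable {ρ : ℝ} {g : ℝ → ℝ}

theorem expTail_pos (s : ℝ) : 0 < expTail ρ g s := Real.exp_pos _

theorem intervalIntegrable_of_integrableOn_Ioi
    (hg : ∀ s, IntegrableOn (fun t => g t - 1) (Set.Ioi s)) (a b : ℝ) :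
    IntervalIntegrable (fun t => g t - 1) volume a b :=
  ⟨(hg a).mono_set Set.Ioc_subset_Ioi_self, (hg b).mono_set Set.Ioc_subset_Ioi_self⟩

/-- With a fixed base point the functional is the exponential of an interval integral, so its
continuity and its derivative come from the fundamental theorem of calculus. -/
theorem expTail_eq (hg : ∀ s, IntegrableOn (fun t => g t - 1) (Set.Ioi s)) (s u : ℝ) :
    expTail ρ g u = Real.exp (ρ * ((∫ t in Set.Ioi s, (g t - 1)) - ∫ t in s..u, (g t - 1))) := by
  rw [expTail, ← intervalIntegral.integral_interval_add_Ioi (hg s) (hg u), add_sub_cancel_left]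

theorem continuous_expTail (hg : ∀ s, IntegrableOn (fun t => g t - 1) (Set.Ioi s)) :
    Continuous (expTail ρ g) := by
  rw [funext (expTail_eq hg 0)]
  exact Real.continuous_exp.comp (continuous_const.mul (continuous_const.sub
    (intervalIntegral.continuous_primitive (intervalIntegrable_of_integrableOn_Ioi hg) 0)))

theorem tendsto_expTail_atTop : Tendsto (expTail ρ g) atTop (𝓝 1) := by
  have h := (tendsto_integral_Ioi_zero (f := fun t => g t - 1) (μ := volume)
    (tendsto_id (α := ℝ) (x := atTop))).const_mul ρ
  have h' := (Real.continuous_exp.tendsto _).comp h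
  rw [mul_zero, Real.exp_zero] at h'
  exact h'

theorem expTail_le (hρ : 0 ≤ ρ) (hg : ∀ s, IntegrableOn (fun t => g t - 1) (Set.Ioi s))
    {s t : ℝ} (hst : s ≤ t) :
    expTail ρ g t ≤ Real.exp (ρ * ∫ u in Set.Ioi s, |g u - 1|) := by
  refine Real.exp_le_exp.2 (mul_le_mul_of_nonneg_left ?_ hρ)
  calc ∫ u in Set.Ioi t, (g u - 1) ≤ ∫ u in Set.Ioi t, |g u - 1| :=
        setIntegral_mono (hg t) (hg t).abs fun _ => le_abs_self _
    _ ≤ ∫ u in Set.Ioi s, |g u - 1| :=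
        setIntegral_mono_set (hg s).abs (ae_of_all _ fun _ => abs_nonneg _)
          (Set.Ioi_subset_Ioi hst).eventuallyLE

theorem hasDerivAt_expTail (hg : ∀ s, IntegrableOn (fun t => g t - 1) (Set.Ioi s)) {u : ℝ}
    (hu : ContinuousAt g u) :
    HasDerivAt (expTail ρ g) (expTail ρ g u * (ρ * -(g u - 1))) u := by
  have h1 : HasDerivAt (fun u => ∫ t in (0 : ℝ)..u, (g t - 1)) (g u - 1) u :=
    intervalIntegral.integral_hasDerivAt_right (intervalIntegrable_of_integrableOn_Ioi hg 0 u)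
      ⟨Set.Ioi (u - 1), Ioi_mem_nhds (by linarith), (hg _).1⟩ (hu.sub continuousAt_const)
  have h2 := ((h1.const_sub (∫ t in Set.Ioi 0, (g t - 1))).const_mul ρ).exp
  rw [← expTail_eq hg 0 u] at h2
  exact h2.congr_of_eventuallyEq (.of_forall (expTail_eq hg 0))

/-- The renewal equation for the functional `expTail`, on the half-line after `s`. -/
theorem setIntegral_expTail (hρ : 0 < ρ)
    (hg : ∀ s, IntegrableOn (fun t => g t - 1) (Set.Ioi s)) {S : Set ℝ} (hS : S.Countable)
    (hc : ∀ t ∉ S, ContinuousAt g t) (s : ℝ) :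
    IntegrableOn (fun t => ρ * Real.exp (-(ρ * (t - s))) * (g t * expTail ρ g t)) (Set.Ioi s) ∧
    ∫ t in Set.Ioi s, ρ * Real.exp (-(ρ * (t - s))) * (g t * expTail ρ g t) = expTail ρ g s := by
  set F' : ℝ → ℝ := fun t => ρ * Real.exp (-(ρ * (t - s))) * (g t * expTail ρ g t) with hF'
  set B := Real.exp (ρ * ∫ u in Set.Ioi s, |g u - 1|)
  have hcont := continuous_expTail (ρ := ρ) hg
  have hbound : ∀ᵐ t ∂(volume.restrict (Set.Ioi s)), ‖expTail ρ g t‖ ≤ B := by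
    filter_upwards [ae_restrict_mem measurableSet_Ioi] with t ht
    rw [Real.norm_of_nonneg (expTail_pos t).le]
    exact expTail_le hρ.le hg (le_of_lt ht)
  have hexp : IntegrableOn (fun t => ρ * Real.exp (-(ρ * (t - s)))) (Set.Ioi s) := by
    have : ∀ t, ρ * Real.exp (-(ρ * (t - s))) = ρ * Real.exp (ρ * s) * Real.exp (-ρ * t) := by
      intro t
      rw [mul_assoc, ← Real.exp_add]
      congr 2
      ring
    simp only [this]
    exact (exp_neg_integrableOn_Ioi s hρ).const_mul _
  -- Split g = 1 + (g - 1): `expTail` is bounded on the half-line, the exponential is integrable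
  -- against the 1, and g - 1 is integrable by itself.
  have hint : IntegrableOn F' (Set.Ioi s) := by
    have h1 : IntegrableOn (fun t => expTail ρ g t * (ρ * Real.exp (-(ρ * (t - s)))))
        (Set.Ioi s) := hexp.bdd_mul hcont.aestronglyMeasurable hbound
    have h2 : IntegrableOn (fun t => (ρ * Real.exp (-(ρ * (t - s)))) *
        (expTail ρ g t * (g t - 1))) (Set.Ioi s) := by
      refine ((hg s).bdd_mul hcont.aestronglyMeasurable hbound).bdd_mul (c := ρ)
        (by fun_prop) ?_
      filter_upwards [ae_restrict_mem measurableSet_Ioi] with t ht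
      rw [Real.norm_of_nonneg (by positivity)]
      refine mul_le_of_le_one_right hρ.le (Real.exp_le_one_iff.2 ?_)
      have := mul_nonneg hρ.le (sub_nonneg.2 (le_of_lt (Set.mem_Ioi.1 ht)))
      linarith
    refine (h1.add h2).congr (ae_of_all _ fun t => ?_)
    simp only [hF', Pi.add_apply]
    ring
  refine ⟨hint, ?_⟩
  -- An antiderivative of `F'` wherever g is continuous, because H' = -ρ (g - 1) H. It vanishes at
  -- infinity, where H tends to 1, so only its value at `s` remains.
  set F : ℝ → ℝ := fun t => -(Real.exp (-(ρ * (t - s))) * expTail ρ g t) with hF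
  have hFc : Continuous F := by fun_prop
  have hd : ∀ t ∉ S, HasDerivAt F (F' t) t := by
    intro t ht
    have h1 : HasDerivAt (fun t : ℝ => Real.exp (-(ρ * (t - s))))
        (Real.exp (-(ρ * (t - s))) * -(ρ * 1)) t :=
      ((((hasDerivAt_id t).sub_const s).const_mul ρ).neg).exp
    refine (h1.mul (hasDerivAt_expTail hg (hc t ht))).neg.congr_deriv ?_
    simp only [hF']
    ring
  have hlim := intervalIntegral_tendsto_integral_Ioi s hint (tendsto_id (α := ℝ) (x := atTop))
  have hFs : F s = -expTail ρ g s := by simp [hF]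
  have hlim2 : Tendsto (fun b => F b - F s) atTop (𝓝 (expTail ρ g s)) := by
    have he : Tendsto (fun b : ℝ => Real.exp (-(ρ * (b - s)))) atTop (𝓝 0) := by
      refine Real.tendsto_exp_neg_atTop_nhds_zero.comp ?_
      exact (tendsto_atTop_add_const_right _ (-s) tendsto_id).const_mul_atTop hρ
    have := ((he.mul (tendsto_expTail_atTop (ρ := ρ) (g := g))).neg).sub_const (F s)
    simpa [hFs] using this
  refine tendsto_nhds_unique (hlim.congr' ?_) hlim2
  filter_upwards [eventually_ge_atTop s] with b hb
  exact integral_eq_of_hasDerivAt_off_countable_of_le F F' hb hS hFc.continuousOn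
    (fun t ht => hd t ht.2)
    ((intervalIntegrable_iff_integrableOn_Ioc_of_le hb).2 (hint.mono_set Set.Ioc_subset_Ioi_self))

/-- The renewal equation for the functional `expTail`. -/
theorem integral_expMeasure_expTail (hρ : 0 < ρ)
    (hg : ∀ s, IntegrableOn (fun t => g t - 1) (Set.Ioi s)) {S : Set ℝ} (hS : S.Countable)
    (hc : ∀ t ∉ S, ContinuousAt g t) (s : ℝ) :
    Integrable (fun w => g (s + w) * expTail ρ g (s + w)) (expMeasure ρ) ∧
    ∫ w, g (s + w) * expTail ρ g (s + w) ∂(expMeasure ρ) = expTail ρ g s := by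
  obtain ⟨hi, hv⟩ := setIntegral_expTail hρ hg hS hc s
  have hmp : MeasurePreserving (fun w : ℝ => s + w) (volume.restrict (Set.Ioi 0))
      (volume.restrict (Set.Ioi s)) := by
    have := (measurePreserving_add_left (volume : Measure ℝ) s).restrict_preimage
      (s := Set.Ioi s) measurableSet_Ioi
    simpa using this
  have hemb : MeasurableEmbedding fun w : ℝ => s + w := measurableEmbedding_addLeft s
  have hm : Measurable fun w : ℝ => ENNReal.ofReal (ρ * Real.exp (-(ρ * w))) := by fun_prop
  have hr : volume.restrict (Set.Ici (0 : ℝ)) = volume.restrict (Set.Ioi 0) :=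
    Measure.restrict_congr_set Ioi_ae_eq_Ici.symm
  have heq : ∀ w : ℝ, (ENNReal.ofReal (ρ * Real.exp (-(ρ * w)))).toReal •
      (g (s + w) * expTail ρ g (s + w)) = (fun t => ρ * Real.exp (-(ρ * (t - s))) *
        (g t * expTail ρ g t)) (s + w) := by
    intro w
    rw [ENNReal.toReal_ofReal (by positivity), smul_eq_mul]
    simp
  rw [expMeasure_eq, hr, integrable_withDensity_iff_integrable_smul' hm
    (ae_of_all _ fun _ => ENNReal.ofReal_lt_top), integral_withDensity_eq_integral_toReal_smul hm
    (ae_of_all _ fun _ => ENNReal.ofReal_lt_top)]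
  simp only [heq]
  exact ⟨(hmp.integrable_comp_emb hemb).2 hi, (hmp.integral_comp hemb _).trans hv⟩

end expTail

/-! ### The duality coupling -/

section Pairing

variable {s r : ℝ}

theorem weight_mul_weight (s r : ℝ) (k : Fin 2 → ℤ) :
    weight s k * weight r k = weight (s + r) k :=
  (Real.rpow_add (base_pos k) s r).symm

theorem weight_zero (k : Fin 2 → ℤ) : weight 0 k = 1 := Real.rpow_zero _

/-- For opposite orders the weights cancel, so the coupling is the real part of the ℓ² inner product
and inherits bilinearity, continuity and Cauchy–Schwarz. -/
theorem inner_toLp_apply (hrs : s + r = 0) (u : Sobolev s) (h : Sobolev r) (k : Fin 2 → ℤ) :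
    inner ℂ (Sobolev.toLp r h k) (Sobolev.toLp s u k) =
      u.coeff k * starRingEnd ℂ (h.coeff k) := by
  change inner ℂ (weighted r h.coeff k) (weighted s u.coeff k) = _
  have h1 : ((weight (s / 2) k : ℝ) : ℂ) * ((weight (r / 2) k : ℝ) : ℂ) = 1 := by
    rw [← Complex.ofReal_mul, weight_mul_weight, show s / 2 + r / 2 = 0 by linarith, weight_zero,
      Complex.ofReal_one]
  rw [RCLike.inner_apply, weighted, weighted, Complex.real_smul, Complex.real_smul, map_mul,
    Complex.conj_ofReal]
  linear_combination (u.coeff k * starRingEnd ℂ (h.coeff k)) * h1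

theorem hasSum_pairing (hrs : s + r = 0) (u : Sobolev s) (h : Sobolev r) :
    HasSum (fun k => (u.coeff k * starRingEnd ℂ (h.coeff k)).re)
      (inner ℂ (Sobolev.toLp r h) (Sobolev.toLp s u)).re := by
  have := lp.hasSum_inner (𝕜 := ℂ) (Sobolev.toLp r h) (Sobolev.toLp s u)
  simp only [inner_toLp_apply hrs] at this
  exact Complex.hasSum_re this

theorem pairing_eq_inner (hrs : s + r = 0) (u : Sobolev s) (h : Sobolev r) :
    pairing u h = (inner ℂ (Sobolev.toLp r h) (Sobolev.toLp s u)).re :=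
  (hasSum_pairing hrs u h).tsum_eq

/-- The duality coupling as a bilinear form. -/
noncomputable def pairingBilin (hrs : s + r = 0) : Sobolev s →ₗ[ℝ] Sobolev r →ₗ[ℝ] ℝ :=
  LinearMap.mk₂ ℝ pairing
    (fun u v h => by simp only [pairing_eq_inner hrs, map_add, inner_add_right, Complex.add_re])
    (fun c u h => by
      simp only [pairing_eq_inner hrs, map_smul, inner_smul_right_eq_smul, Complex.smul_re])
    (fun u h h' => by simp only [pairing_eq_inner hrs, map_add, inner_add_left, Complex.add_re])
    (fun c u h => by
      simp only [pairing_eq_inner hrs, map_smul, inner_smul_left_eq_smul, Complex.smul_re])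

theorem pairingBilin_apply (hrs : s + r = 0) (u : Sobolev s) (h : Sobolev r) :
    pairingBilin hrs u h = pairing u h := rfl

theorem continuous_pairing (hrs : s + r = 0) :
    Continuous fun p : Sobolev s × Sobolev r => pairing p.1 p.2 := by
  simp only [pairing_eq_inner hrs]
  exact Complex.continuous_re.comp
    (((Sobolev.isometry_toLp r).continuous.comp continuous_snd).inner
      ((Sobolev.isometry_toLp s).continuous.comp continuous_fst))

theorem continuous_pairing_left (hrs : s + r = 0) (h : Sobolev r) :
    Continuous fun u : Sobolev s => pairing u h :=
  (continuous_pairing hrs).comp (Continuous.prodMk_left h)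

theorem pairing_add_left (hrs : s + r = 0) (u v : Sobolev s) (h : Sobolev r) :
    pairing (u + v) h = pairing u h + pairing v h :=
  LinearMap.map_add₂ (pairingBilin hrs) u v h

theorem pairing_smul_left (hrs : s + r = 0) (c : ℝ) (u : Sobolev s) (h : Sobolev r) :
    pairing (c • u) h = c * pairing u h :=
  LinearMap.map_smul₂ (pairingBilin hrs) c u h

theorem pairing_smul_right (hrs : s + r = 0) (c : ℝ) (u : Sobolev s) (h : Sobolev r) :
    pairing u (c • h) = c * pairing u h :=
  map_smul (pairingBilin hrs u) c h

theorem abs_pairing_le (hrs : s + r = 0) (u : Sobolev s) (h : Sobolev r) :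
    |pairing u h| ≤ ‖u‖ * ‖h‖ := by
  rw [pairing_eq_inner hrs, mul_comm]
  exact (Complex.abs_re_le_norm _).trans (norm_inner_le_norm _ _)

/-- The Riesz representative of `v`, with coefficients `weight s k • v.coeff k`, lies in H^(-s) and
couples with `v` to ‖v‖². Test functions therefore separate points, which is what makes the
characteristic functional determine a law. -/
theorem pairingBilin_ne_zero (hrs : s + r = 0) {v : Sobolev s} (hv : v ≠ 0) :
    pairingBilin hrs v ≠ 0 := by
  have hsq : ∀ k, weight r k * ‖weight s k • v.coeff k‖ ^ 2 = weight s k * ‖v.coeff k‖ ^ 2 := by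
    intro k
    rw [norm_smul, mul_pow, Real.norm_of_nonneg (weight_pos s k).le, sq, ← mul_assoc, ← mul_assoc,
      mul_comm (weight r k), weight_mul_weight, hrs, weight_zero, one_mul]
  let h : Sobolev r := ⟨fun k => weight s k • v.coeff k, fun k => by
    have : v.coeff (-k) = starRingEnd ℂ (v.coeff k) := v.2.1 k
    have hneg : weight s (-k) = weight s k := by simp [weight]
    simp only [this, hneg]
    rw [Complex.real_smul, Complex.real_smul, map_mul, Complex.conj_ofReal], by
    simp only [hsq]
    exact v.2.2⟩
  intro h0
  have h1 : pairing v h = ‖v‖ ^ 2 := by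
    rw [Sobolev.norm_sq]
    refine tsum_congr fun k => ?_
    change (v.coeff k * starRingEnd ℂ (weight s k • v.coeff k)).re = _
    rw [Complex.real_smul, map_mul, Complex.conj_ofReal, mul_left_comm, Complex.mul_conj,
      ← Complex.ofReal_mul, Complex.ofReal_re, Complex.normSq_eq_norm_sq]
  have h2 : pairing v h = 0 := by rw [← pairingBilin_apply hrs, h0]; rfl
  rw [h2] at h1
  exact hv (norm_eq_zero.1 (pow_eq_zero_iff two_ne_zero |>.1 h1.symm))

theorem l2NormSq_smul (c : ℝ) (h : Sobolev r) : l2NormSq (c • h) = c ^ 2 * l2NormSq h := by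
  rw [l2NormSq, l2NormSq, ← tsum_mul_left]
  refine tsum_congr fun k => ?_
  change ‖c • h.coeff k‖ ^ 2 = _
  rw [norm_smul, mul_pow, Real.norm_eq_abs, sq_abs]

theorem l2NormSq_nonneg (h : Sobolev r) : 0 ≤ l2NormSq h := tsum_nonneg fun _ => sq_nonneg _

end Pairing

/-! ### The hyperbolic cosine of the norm of a Hilbert space -/

/-- Convexity of the power: `p` and `q` are mirror-image convex combinations of `A` and `B`. -/
theorem add_pow_le_of_mem_Icc {A B p q : ℝ} (hA : 0 ≤ A) (hAp : A ≤ p) (hpB : p ≤ B)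
    (hpq : p + q = A + B) (n : ℕ) : p ^ n + q ^ n ≤ A ^ n + B ^ n := by
  have hB : 0 ≤ B := hA.trans (hAp.trans hpB)
  rcases eq_or_lt_of_le (hAp.trans hpB) with rfl | hAB
  · obtain rfl : p = A := le_antisymm hpB hAp
    obtain rfl : q = p := by linarith
    rfl
  have hd : 0 < B - A := sub_pos.2 hAB
  set t := (p - A) / (B - A)
  have ht : t * (B - A) = p - A := div_mul_cancel₀ _ hd.ne'
  have ht0 : 0 ≤ t := div_nonneg (by linarith) hd.le
  have ht1 : t ≤ 1 := (div_le_one hd).2 (by linarith)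
  have hc := convexOn_pow (𝕜 := ℝ) n
  have h1 := hc.2 (Set.mem_Ici.2 hA) (Set.mem_Ici.2 hB) (sub_nonneg.2 ht1) ht0 (by ring)
  have h2 := hc.2 (Set.mem_Ici.2 hA) (Set.mem_Ici.2 hB) ht0 (sub_nonneg.2 ht1) (by ring)
  simp only [smul_eq_mul] at h1 h2
  rw [show (1 - t) * A + t * B = p by linarith] at h1
  rw [show t * A + (1 - t) * B = q by linarith] at h2
  linarith

/-- The right side is cosh(a - b) + cosh(a + b). In the power series of cosh only powers of the
squares occur, and the squares of p and q are less spread out than those of a - b and a + b, with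
the same sum; compare term by term. -/
theorem cosh_add_cosh_le {a b p q : ℝ} (hlow : |a - b| ≤ |p|) (hhigh : |p| ≤ |a + b|)
    (hpq : p ^ 2 + q ^ 2 = (a - b) ^ 2 + (a + b) ^ 2) :
    Real.cosh p + Real.cosh q ≤ 2 * (Real.cosh a * Real.cosh b) := by
  have h : 2 * (Real.cosh a * Real.cosh b) = Real.cosh (a - b) + Real.cosh (a + b) := by
    rw [Real.cosh_add, Real.cosh_sub]; ring
  rw [h]
  refine hasSum_le (fun n => ?_) ((Real.hasSum_cosh p).add (Real.hasSum_cosh q))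
    ((Real.hasSum_cosh (a - b)).add (Real.hasSum_cosh (a + b)))
  rw [← add_div, ← add_div]
  refine div_le_div_of_nonneg_right ?_ (by positivity)
  simp only [pow_mul]
  exact add_pow_le_of_mem_Icc (sq_nonneg _) (sq_le_sq.2 hlow) (sq_le_sq.2 hhigh) hpq n

/-- The triangle inequalities and the parallelogram law are exactly what the scalar inequality asks
for. Hence a jump of random sign multiplies the mean of cosh‖u‖ by at most the cosh of its size,
with no loss of constant. -/
theorem cosh_norm_add_add_cosh_norm_sub_le {s : ℝ} (u v : Sobolev s) :
    Real.cosh ‖u + v‖ + Real.cosh ‖u - v‖ ≤ 2 * (Real.cosh ‖u‖ * Real.cosh ‖v‖) := by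
  refine cosh_add_cosh_le ?_ ?_ ?_
  · rw [abs_of_nonneg (norm_nonneg (u + v))]
    have := abs_norm_sub_norm_le u (-v)
    rwa [norm_neg, sub_neg_eq_add] at this
  · rw [abs_of_nonneg (norm_nonneg (u + v)), abs_of_nonneg (by positivity)]
    exact norm_add_le u v
  · have h := parallelogram_law_with_norm ℂ (Sobolev.toLp s u) (Sobolev.toLp s v)
    rw [← map_add, ← map_sub] at h
    have h' : ‖u + v‖ ^ 2 + ‖u - v‖ ^ 2 = 2 * (‖u‖ ^ 2 + ‖v‖ ^ 2) := h
    linarith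

/-! ### Compact diagonal operators on `ℓ²` -/

section Diagonal

variable {ι : Type*}

theorem memlp_diagonal {m : ι → ℝ} {C : ℝ} (hm : ∀ k, |m k| ≤ C)
    (v : lp (fun _ : ι => ℂ) 2) : Memℓp (fun k => m k • v k) 2 := by
  have hv : Memℓp (C • (v : ι → ℂ)) 2 := (lp.memℓp v).const_smul C
  refine hv.mono' fun k => ?_
  rw [Pi.smul_apply, norm_smul, norm_smul, Real.norm_eq_abs, Real.norm_eq_abs]
  exact mul_le_mul_of_nonneg_right ((hm k).trans (le_abs_self C)) (norm_nonneg _)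

theorem norm_diagonal_le {m : ι → ℝ} {C : ℝ} (hC : 0 ≤ C) {v w : lp (fun _ : ι => ℂ) 2}
    (hm : ∀ k, |m k| ≤ C) (hw : ∀ k, w k = m k • v k) : ‖w‖ ≤ C * ‖v‖ := by
  have h : ‖w‖ ≤ ‖C • v‖ := by
    refine lp.norm_mono two_ne_zero fun k => ?_
    rw [hw, lp.coeFn_smul, Pi.smul_apply, norm_smul, norm_smul, Real.norm_eq_abs,
      Real.norm_of_nonneg hC]
    gcongr
    exact hm k
  rwa [norm_smul, Real.norm_of_nonneg hC] at h

/-- The operator on `ℓ²` which multiplies the `k`-th entry by `m k`. -/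
noncomputable def diagonal (m : ι → ℝ) (C : ℝ) (hm : ∀ k, |m k| ≤ C) :
    lp (fun _ : ι => ℂ) 2 →L[ℝ] lp (fun _ : ι => ℂ) 2 :=
  LinearMap.mkContinuous
    { toFun := fun v => ⟨fun k => m k • v k, memlp_diagonal hm v⟩
      map_add' := fun v w => Subtype.ext (funext fun k => smul_add (m k) (v k) (w k))
      map_smul' := fun c v => Subtype.ext (funext fun k => smul_comm (m k) c (v k)) }
    |C| fun _ => norm_diagonal_le (abs_nonneg C) (fun k => (hm k).trans (le_abs_self C))
      fun _ => rfl

theorem diagonal_apply (m : ι → ℝ) (C : ℝ) (hm : ∀ k, |m k| ≤ C) (v : lp (fun _ : ι => ℂ) 2)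
    (k : ι) : diagonal m C hm v k = m k • v k := rfl

/-- The operator is the norm limit of its finite truncations, each a finite sum of operators
factoring through ℂ. -/
theorem isCompactOperator_diagonal (m : ι → ℝ) (C : ℝ) (hm : ∀ k, |m k| ≤ C)
    (h0 : Tendsto m cofinite (𝓝 0)) : IsCompactOperator (diagonal m C hm) := by
  classical
  let F : Finset ι → lp (fun _ : ι => ℂ) 2 →L[ℝ] lp (fun _ : ι => ℂ) 2 := fun S =>
    ∑ k ∈ S, m k • (lp.singleContinuousLinearMap ℝ (fun _ : ι => ℂ) 2 k).comp
      (lp.evalCLM ℝ (fun _ : ι => ℂ) 2 k)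
  have hFapply : ∀ S v k, F S v k = if k ∈ S then m k • v k else 0 := by
    intro S v k
    have : F S v = ∑ j ∈ S, m j • lp.single 2 j (v j) := by
      simp only [F, _root_.sum_apply, _root_.smul_apply]
      rfl
    rw [this, lp.coeFn_sum, Finset.sum_apply]
    simp only [lp.coeFn_smul, Pi.smul_apply, lp.single_apply, Pi.single_apply, smul_ite, smul_zero]
    rw [Finset.sum_ite_eq S k]
  refine isCompactOperator_of_tendsto (F := F) (l := atTop) ?_ (.of_forall fun S => ?_)
  · rw [Metric.tendsto_nhds]
    intro ε hε
    have hfin : {k | ¬ |m k| < ε / 2}.Finite := by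
      have := (Metric.tendsto_nhds.1 h0) (ε / 2) (half_pos hε)
      simpa [Real.dist_eq] using this
    filter_upwards [eventually_ge_atTop hfin.toFinset] with S hS
    rw [dist_comm, dist_eq_norm]
    refine lt_of_le_of_lt (ContinuousLinearMap.opNorm_le_bound _ (half_pos hε).le fun v => ?_)
      (half_lt_self hε)
    -- The error of the truncation is again diagonal, with entries zero on `S` and at most ε/2
    -- elsewhere.
    refine norm_diagonal_le (m := fun k => if k ∈ S then 0 else m k) (half_pos hε).le
      (fun k => ?_) fun k => ?_
    · split_ifs with hk
      · simpa using (half_pos hε).le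
      · by_contra hlt
        exact hk (hS (hfin.mem_toFinset.2 fun h => hlt h.le))
    · rw [_root_.sub_apply, lp.coeFn_sub, Pi.sub_apply, hFapply, diagonal_apply]
      split_ifs <;> simp
  · have : ∀ T : Finset ι, IsCompactOperator (F T) := by
      intro T
      refine Finset.induction_on T ?_ fun k T hk ih => ?_
      · exact isCompactOperator_zero
      · have hadd : F (insert k T) = m k • (lp.singleContinuousLinearMap ℝ (fun _ : ι => ℂ) 2 k).comp
            (lp.evalCLM ℝ (fun _ : ι => ℂ) 2 k) + F T := Finset.sum_insert hk
        rw [hadd]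
        refine IsCompactOperator.add (IsCompactOperator.smul ?_ (m k)) ih
        have hk : IsCompactOperator (lp.evalCLM ℝ (fun _ : ι => ℂ) 2 k) :=
          isCompactOperator_of_locallyCompactSpace_dom _
        exact hk.clm_comp (lp.singleContinuousLinearMap ℝ (fun _ : ι => ℂ) 2 k)
    exact this S

end Diagonal

/-! ### Parseval's identity for test functions -/

section Parseval

variable {r : ℝ}

/-- Write the coefficient as a product of (1+|k|²)^(-r/2) and its weighted modulus and use 2xy ≤ x²
+ y²; in dimension two the first squares are summable for r > 1. -/
theorem summable_norm_coeff (hr : 1 < r) (h : Sobolev r) : Summable fun k => ‖h.coeff k‖ := by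
  have h1 : Summable (weight (-r)) := by
    have := summable_weight (δ := r - 1) (by linarith)
    rwa [show -1 - (r - 1) = -r by ring] at this
  have h2 : Summable fun k => weight r k * ‖h.coeff k‖ ^ 2 := h.2.2
  refine .of_nonneg_of_le (fun _ => norm_nonneg _) (fun k => ?_) (h1.add h2)
  have hw : weight (-r / 2) k * weight (r / 2) k = 1 := by
    rw [weight_mul_weight, show -r / 2 + r / 2 = 0 by ring, weight_zero]
  rw [← weight_half_sq (-r), ← weight_half_sq r]
  have := two_mul_le_add_sq (weight (-r / 2) k) (weight (r / 2) k * ‖h.coeff k‖)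
  rw [mul_assoc, ← mul_assoc (weight (-r / 2) k), hw, one_mul, mul_pow] at this
  linarith [norm_nonneg (h.coeff k)]

theorem pairing_diracMass {δ : ℝ} (hδ : 0 < δ) (h : Sobolev (1 + δ)) (x : Torus) :
    ((pairing (diracMass hδ x) h : ℝ) : ℂ) = ∑' k, h.coeff k * UnitAddTorus.mFourier k x := by
  have hs : Summable fun k => h.coeff k * UnitAddTorus.mFourier k x := by
    refine .of_norm ?_
    simpa [norm_mFourier_apply] using summable_norm_coeff (by linarith) h
  have hreal : starRingEnd ℂ (∑' k, h.coeff k * UnitAddTorus.mFourier k x) =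
      ∑' k, h.coeff k * UnitAddTorus.mFourier k x := by
    rw [Complex.conj_tsum, ← (Equiv.neg (Fin 2 → ℤ)).tsum_eq]
    refine tsum_congr fun k => ?_
    have : h.coeff (-k) = starRingEnd ℂ (h.coeff k) := h.2.1 k
    rw [Equiv.neg_apply, map_mul, this, Complex.conj_conj, UnitAddTorus.mFourier_neg,
      Complex.conj_conj]
  rw [← Complex.conj_eq_iff_re.1 hreal, Complex.re_tsum hs]
  congr 1
  refine tsum_congr fun k => ?_
  change (UnitAddTorus.mFourier (-k) x * starRingEnd ℂ (h.coeff k)).re = _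
  rw [UnitAddTorus.mFourier_neg, ← map_mul, Complex.conj_re, mul_comm]

theorem orthonormal_mFourier_torusMeasure : Orthonormal ℂ fun k : Fin 2 → ℤ =>
    ContinuousMap.toLp (E := ℂ) 2 torusMeasure ℂ (UnitAddTorus.mFourier k) :=
  UnitAddTorus.orthonormal_mFourier

/-- No completeness of the family is needed, since `f` is given as the sum of its expansion. -/
theorem hasSum_norm_sq_of_orthonormal {κ E : Type*} [NormedAddCommGroup E] [InnerProductSpace ℂ E]
    {b : κ → E} (hb : Orthonormal ℂ b) {a : κ → ℂ} {f : E} (hf : HasSum (fun k => a k • b k) f) :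
    HasSum (fun k => ‖a k‖ ^ 2) (‖f‖ ^ 2) := by
  classical
  have hcoord : ∀ j, inner ℂ f (b j) = starRingEnd ℂ (a j) := by
    intro j
    have h1 := hf.mapL (innerSL ℂ (b j))
    simp only [innerSL_apply_apply, inner_smul_right, orthonormal_iff_ite.1 hb] at h1
    have h2 : inner ℂ (b j) f = a j := by
      have h3 := hasSum_single (f := fun k => a k * if j = k then (1 : ℂ) else 0) j
        (fun k hk => by simp [hk.symm])
      exact h1.unique (by simpa using h3)
    rw [← h2, inner_conj_symm]
  have h1 := hf.mapL (innerSL ℂ f)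
  simp only [innerSL_apply_apply, inner_smul_right, hcoord, Complex.mul_conj,
    inner_self_eq_norm_sq_to_K] at h1
  simpa [Complex.normSq_eq_norm_sq, ← Complex.ofReal_pow] using Complex.hasSum_re h1

/-- This is how the L² norm enters the limit: coupling with a Dirac mass evaluates the uniformly
convergent Fourier series of `h`, and Parseval gives its mean square at a uniform point. -/
theorem integral_pairing_diracMass_sq {δ : ℝ} (hδ : 0 < δ) (h : Sobolev (1 + δ)) :
    ∫ x, pairing (diracMass hδ x) h ^ 2 ∂torusMeasure = l2NormSq h := by
  have hsum : Summable fun k => ‖h.coeff k‖ := summable_norm_coeff (by linarith) h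
  have hC : Summable fun k => h.coeff k • UnitAddTorus.mFourier (d := Fin 2) k := by
    refine .of_norm ?_
    simpa [norm_smul, UnitAddTorus.mFourier_norm] using hsum
  set f : C(Torus, ℂ) := ∑' k, h.coeff k • UnitAddTorus.mFourier (d := Fin 2) k
  have hf := hC.hasSum.mapL (ContinuousMap.toLp (E := ℂ) 2 torusMeasure ℂ)
  simp only [map_smul] at hf
  change HasSum _ (ContinuousMap.toLp (E := ℂ) 2 torusMeasure ℂ f) at hf
  have hfx : ∀ x, f x = (pairing (diracMass hδ x) h : ℝ) := by
    intro x
    rw [pairing_diracMass]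
    exact ((hC.hasSum.mapL (ContinuousMap.evalCLM ℂ x)).tsum_eq).symm
  have h2 := (hasSum_norm_sq_of_orthonormal orthonormal_mFourier_torusMeasure hf).tsum_eq
  rw [l2NormSq, h2, ← RCLike.ofReal_inj (K := ℂ)]
  rw [RCLike.ofReal_pow, ← inner_self_eq_norm_sq_to_K, ContinuousMap.inner_toLp]
  rw [← integral_ofReal]
  refine integral_congr_ae (ae_of_all _ fun x => ?_)
  simp [hfx, sq]

end Parseval

/-! ### The chain of jumps -/

theorem lintegral_signMeasure (f : ℝ → ℝ≥0∞) :
    ∫⁻ σ, f σ ∂signMeasure = 2⁻¹ * (f 1 + f (-1)) := by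
  rw [signMeasure, lintegral_smul_measure, lintegral_add_measure, lintegral_dirac, lintegral_dirac,
    smul_eq_mul]

theorem isProbabilityMeasure_markMeasure {ρ : ℝ} (hρ : 0 < ρ) :
    IsProbabilityMeasure (markMeasure ρ) := by
  have := isProbabilityMeasure_expMeasure hρ
  unfold markMeasure
  infer_instance

open Classical in
/-- The exponential decay `exp (-θ t)`, cut off after the time `M`. -/
noncomputable def decay (θ : ℝ) (M : ℝ≥0∞) (t : ℝ) : ℝ :=
  if ENNReal.ofReal t ≤ M then Real.exp (-θ * t) else 0

theorem measurable_decay (θ : ℝ) (M : ℝ≥0∞) : Measurable (decay θ M) := by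
  classical
  unfold decay
  refine Measurable.ite ?_ (by fun_prop) measurable_const
  exact measurableSet_le ENNReal.measurable_ofReal measurable_const

theorem decay_nonneg (θ : ℝ) (M : ℝ≥0∞) (t : ℝ) : 0 ≤ decay θ M t := by
  unfold decay; split_ifs <;> positivity

theorem decay_le (θ : ℝ) (M : ℝ≥0∞) (t : ℝ) : decay θ M t ≤ Real.exp (-θ * t) := by
  unfold decay; split_ifs
  · exact le_rfl
  · positivity

section Chain

variable {δ : ℝ} (hδ : 0 < δ)

theorem vortexSum_eq (θ : ℝ) (M : ℝ≥0∞) (z : ℕ → ℝ × ℝ × Torus) :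
    vortexSum hδ θ M z =
      ∑' i, (jumpSign z i * decay θ M (jumpTime z i)) • diracMass hδ (jumpPos z i) := by
  unfold vortexSum decay
  refine tsum_congr fun i => ?_
  split_ifs <;> simp

/-- The norm in `H^(-1-δ)` of the Dirac masses. -/
noncomputable def diracNorm (δ : ℝ) : ℝ := √(∑' k, weight (-1 - δ) k)

theorem diracNorm_nonneg (δ : ℝ) : 0 ≤ diracNorm δ := Real.sqrt_nonneg _

theorem norm_diracMass (x : Torus) : ‖diracMass hδ x‖ = diracNorm δ := by
  rw [diracNorm, eq_comm, Real.sqrt_eq_iff_eq_sq (tsum_nonneg fun k => (weight_pos _ k).le)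
    (norm_nonneg _), Sobolev.norm_sq]
  refine tsum_congr fun k => ?_
  change _ = _ * ‖UnitAddTorus.mFourier (-k) x‖ ^ 2
  rw [norm_mFourier_apply, one_pow, mul_one]

/-- The chain of the jump times together with the partial sums of the random distribution. -/
noncomputable def jumpStep (a : ℝ → ℝ) (e : ℝ × Sobolev (-1 - δ)) (m : ℝ × ℝ × Torus) :
    ℝ × Sobolev (-1 - δ) :=
  (e.1 + m.1, e.2 + (m.2.1 * a (e.1 + m.1)) • diracMass hδ m.2.2)

theorem measurable_jumpStep {a : ℝ → ℝ} (ha : Measurable a) :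
    Measurable (Function.uncurry (jumpStep hδ a)) := by
  have hd : Measurable (diracMass hδ) := (continuous_diracMass hδ).measurable
  unfold jumpStep Function.uncurry
  fun_prop

/-- State `n` contains the jumps of index below `n`, so for positive `n` its time is that of jump `n
- 1`. -/
theorem markovState_jumpStep (a : ℝ → ℝ) (z : ℕ → ℝ × ℝ × Torus) (n : ℕ) :
    markovState (jumpStep hδ a) (0, 0) z n = (∑ j ∈ Finset.range n, (z j).1,
      ∑ i ∈ Finset.range n, (jumpSign z i * a (jumpTime z i)) • diracMass hδ (jumpPos z i)) := by
  induction n with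
  | zero => simp [markovState]
  | succ n ih =>
    rw [markovState, ih, Finset.sum_range_succ, Finset.sum_range_succ, jumpStep]
    simp only [jumpTime, Finset.sum_range_succ]
    rfl

end Chain

/-! ### Almost sure properties of the jumps -/

section AlmostSure

variable {ρ θ : ℝ}

theorem ae_abs_jumpSign (hρ : 0 < ρ) : ∀ᵐ z ∂(sampleMeasure ρ), ∀ i, |jumpSign z i| = 1 := by
  have := isProbabilityMeasure_expMeasure hρ
  have := isProbabilityMeasure_markMeasure hρ
  rw [ae_all_iff]
  intro i
  have h1 : ∀ᵐ σ ∂signMeasure, |σ| = 1 := by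
    rw [signMeasure]
    refine Measure.ae_smul_measure ?_ _
    rw [ae_add_measure_iff]
    constructor <;> rw [ae_dirac_eq] <;> simp
  have h2 : MeasurePreserving (fun z : ℕ → ℝ × ℝ × Torus => (z i).2.1) (sampleMeasure ρ)
      signMeasure :=
    measurePreserving_fst.comp (measurePreserving_snd.comp
      (measurePreserving_eval_infinitePi (fun _ => markMeasure ρ) i))
  exact h2.quasiMeasurePreserving.ae h1

theorem lintegral_exp_jumpTime_le (hρ : 0 < ρ) (hθ : 0 < θ) (n : ℕ) :
    ∫⁻ z, ENNReal.ofReal (Real.exp (-θ * jumpTime z n)) ∂(sampleMeasure ρ) ≤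
      ENNReal.ofReal (ρ / (ρ + θ)) ^ (n + 1) := by
  have := isProbabilityMeasure_expMeasure hρ
  have := isProbabilityMeasure_markMeasure hρ
  have hstate : ∀ z : ℕ → ℝ × ℝ × Torus, ∀ n,
      markovState (fun (e : ℝ) m => e + m.1) 0 z n = ∑ j ∈ Finset.range n, (z j).1 := by
    intro z n
    induction n with
    | zero => rfl
    | succ n ih => rw [markovState, ih, Finset.sum_range_succ]
  have h := lintegral_markovState_le (markMeasure ρ)
    (step := fun (e : ℝ) (m : ℝ × ℝ × Torus) => e + m.1)
    (T := fun e => ENNReal.ofReal (Real.exp (-θ * e))) (q := ENNReal.ofReal (ρ / (ρ + θ)))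
    (by unfold Function.uncurry; fun_prop) (by fun_prop) (fun e => ?_) (n + 1) 0
  · simp only [hstate, mul_zero, Real.exp_zero, ENNReal.ofReal_one, mul_one] at h
    exact h
  · have hmp : MeasurePreserving Prod.fst (markMeasure ρ) (expMeasure ρ) := measurePreserving_fst
    have hf : Measurable fun w : ℝ => ENNReal.ofReal (Real.exp (-θ * (e + w))) := by fun_prop
    rw [hmp.lintegral_comp hf]
    simp only [mul_add, Real.exp_add]
    simp only [ENNReal.ofReal_mul (Real.exp_pos (-θ * e)).le]
    rw [lintegral_const_mul _ (by fun_prop), lintegral_exp_expMeasure hρ hθ, mul_comm]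

/-- The expectations are bounded by a geometric series. This makes the series defining `vortexSum`
absolutely convergent almost surely, even for `M = ∞`, so its `tsum` is not the default value. -/
theorem ae_summable_exp_jumpTime (hρ : 0 < ρ) (hθ : 0 < θ) :
    ∀ᵐ z ∂(sampleMeasure ρ), Summable fun i => Real.exp (-θ * jumpTime z i) := by
  have hm : ∀ i, Measurable fun z : ℕ → ℝ × ℝ × Torus =>
      ENNReal.ofReal (Real.exp (-θ * jumpTime z i)) := by
    intro i; unfold jumpTime; fun_prop
  have hq : ENNReal.ofReal (ρ / (ρ + θ)) < 1 := by
    rw [ENNReal.ofReal_lt_one, div_lt_one (by positivity)]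
    linarith
  have hfin : ∫⁻ z, ∑' i, ENNReal.ofReal (Real.exp (-θ * jumpTime z i)) ∂(sampleMeasure ρ) ≠ ∞ := by
    rw [lintegral_tsum fun i => (hm i).aemeasurable]
    refine ne_top_of_le_ne_top ?_ (ENNReal.tsum_le_tsum fun i => lintegral_exp_jumpTime_le hρ hθ i)
    rw [ENNReal.tsum_geometric_add_one]
    exact ENNReal.mul_ne_top ENNReal.ofReal_ne_top
      (ENNReal.inv_ne_top.2 (tsub_pos_of_lt hq).ne')
  filter_upwards [ae_lt_top (Measurable.tsum hm) hfin] with z hz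
  have := ENNReal.summable_toReal hz.ne
  simpa [ENNReal.toReal_ofReal (Real.exp_pos _).le] using this

/-- Summability of exp(-θ t_i) already forces t_i → ∞, so no law of large numbers is needed. -/
theorem tendsto_sum_waiting {z : ℕ → ℝ × ℝ × Torus} (hθ : 0 < θ)
    (hz : Summable fun i => Real.exp (-θ * jumpTime z i)) :
    Tendsto (fun n => ∑ j ∈ Finset.range n, (z j).1) atTop atTop := by
  rw [← tendsto_add_atTop_iff_nat 1]
  have h1 := Real.tendsto_exp_comp_nhds_zero.1 hz.tendsto_atTop_zero
  have h2 := (tendsto_neg_atBot_atTop.comp h1).atTop_div_const hθ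
  refine h2.congr fun n => ?_
  simp only [Function.comp_apply, jumpTime]
  field_simp

variable {δ : ℝ} (hδ : 0 < δ)

theorem norm_jump_le {z : ℕ → ℝ × ℝ × Torus} (hs : ∀ i, |jumpSign z i| = 1) {a : ℝ → ℝ} {C : ℝ}
    (ha : ∀ t, |a t| ≤ C * Real.exp (-θ * t)) (i : ℕ) :
    ‖(jumpSign z i * a (jumpTime z i)) • diracMass hδ (jumpPos z i)‖ ≤
      C * Real.exp (-θ * jumpTime z i) * diracNorm δ := by
  rw [norm_smul, norm_diracMass, norm_mul, Real.norm_eq_abs, Real.norm_eq_abs, hs, one_mul]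
  exact mul_le_mul_of_nonneg_right (ha _) (diracNorm_nonneg δ)

theorem summable_jump {z : ℕ → ℝ × ℝ × Torus} (hs : ∀ i, |jumpSign z i| = 1)
    (hz : Summable fun i => Real.exp (-θ * jumpTime z i)) {a : ℝ → ℝ} {C : ℝ}
    (ha : ∀ t, |a t| ≤ C * Real.exp (-θ * t)) :
    Summable fun i => (jumpSign z i * a (jumpTime z i)) • diracMass hδ (jumpPos z i) :=
  .of_norm_bounded ((hz.mul_left C).mul_right _) (norm_jump_le hδ hs ha)

theorem abs_mul_decay_le {c : ℝ} (hc : 0 ≤ c) (M : ℝ≥0∞) (t : ℝ) :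
    |c * decay θ M t| ≤ c * Real.exp (-θ * t) := by
  rw [abs_of_nonneg (mul_nonneg hc (decay_nonneg _ _ _))]
  exact mul_le_mul_of_nonneg_left (decay_le _ _ _) hc

theorem ae_tendsto_markovState (hρ : 0 < ρ) (hθ : 0 < θ) (c : ℝ) (M : ℝ≥0∞) :
    ∀ᵐ z ∂(sampleMeasure ρ),
      Tendsto (fun n => (markovState (jumpStep hδ fun t => c * decay θ M t) (0, 0) z n).1)
        atTop atTop ∧
      Tendsto (fun n => (markovState (jumpStep hδ fun t => c * decay θ M t) (0, 0) z n).2)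
        atTop (𝓝 (c • vortexSum hδ θ M z)) := by
  filter_upwards [ae_abs_jumpSign hρ, ae_summable_exp_jumpTime hρ hθ] with z hs hz
  simp only [markovState_jumpStep]
  refine ⟨tendsto_sum_waiting hθ hz, ?_⟩
  have h := (summable_jump hδ hs hz (a := decay θ M) (C := 1)
    fun t => by simpa using abs_mul_decay_le zero_le_one M t).hasSum.const_smul c
  rw [← vortexSum_eq] at h
  refine h.tendsto_sum_nat.congr fun n => Finset.sum_congr rfl fun i _ => ?_
  rw [smul_smul]
  congr 1
  ring

end AlmostSure

/-! ### A uniform exponential moment -/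

section ExpMoment

variable {θ : ℝ}

/-- Combine cosh x ≤ exp(y), where y = x²/2, with exp(y) - 1 ≤ y exp(y). -/
theorem cosh_sub_one_le (x : ℝ) : Real.cosh x - 1 ≤ x ^ 2 / 2 * Real.exp (x ^ 2 / 2) := by
  have h1 := Real.cosh_le_exp_half_sq x
  have h2 := Real.add_one_le_exp (-(x ^ 2 / 2))
  have h3 := mul_le_mul_of_nonneg_right h2 (Real.exp_pos (x ^ 2 / 2)).le
  rw [← Real.exp_add, neg_add_cancel, Real.exp_zero] at h3
  linarith

theorem integrableOn_exp_neg_two_mul (hθ : 0 < θ) (s : ℝ) :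
    IntegrableOn (fun t => Real.exp (-θ * t) ^ 2) (Set.Ioi s) := by
  have : ∀ t, Real.exp (-θ * t) ^ 2 = Real.exp (-(2 * θ) * t) := by
    intro t
    rw [← Real.exp_nat_mul]
    congr 1
    push_cast
    ring
  simp only [this]
  exact exp_neg_integrableOn_Ioi s (by positivity)

/-- The constant keeps exp(-θs) because `s` may be negative. -/
theorem abs_cosh_exp_sub_one_le (hθ : 0 < θ) (κ : ℝ) {s t : ℝ} (hst : s ≤ t) :
    |Real.cosh (κ * Real.exp (-θ * t)) - 1| ≤
      κ ^ 2 / 2 * Real.exp (κ ^ 2 / 2 * Real.exp (-θ * s) ^ 2) * Real.exp (-θ * t) ^ 2 := by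
  have hts : Real.exp (-θ * t) ≤ Real.exp (-θ * s) := by
    refine Real.exp_le_exp.2 ?_
    nlinarith
  rw [abs_of_nonneg (sub_nonneg.2 (Real.one_le_cosh _))]
  refine (cosh_sub_one_le _).trans ?_
  have h1 : (κ * Real.exp (-θ * t)) ^ 2 / 2 ≤ κ ^ 2 / 2 * Real.exp (-θ * s) ^ 2 := by
    rw [mul_pow, mul_div_right_comm]
    gcongr
  calc _ ≤ (κ * Real.exp (-θ * t)) ^ 2 / 2 * Real.exp (κ ^ 2 / 2 * Real.exp (-θ * s) ^ 2) := by
        gcongr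
    _ = _ := by ring

theorem integrableOn_cosh_exp_sub_one (hθ : 0 < θ) (κ s : ℝ) :
    IntegrableOn (fun t => Real.cosh (κ * Real.exp (-θ * t)) - 1) (Set.Ioi s) := by
  refine ((integrableOn_exp_neg_two_mul hθ s).const_mul
    (κ ^ 2 / 2 * Real.exp (κ ^ 2 / 2 * Real.exp (-θ * s) ^ 2))).mono'
    (Continuous.aestronglyMeasurable (by fun_prop)) ?_
  filter_upwards [ae_restrict_mem measurableSet_Ioi] with t ht
  exact abs_cosh_exp_sub_one_le hθ κ (le_of_lt ht)

theorem integral_exp_neg_two_mul (hθ : 0 < θ) (s : ℝ) :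
    ∫ t in Set.Ioi s, Real.exp (-θ * t) ^ 2 = Real.exp (-2 * θ * s) / (2 * θ) := by
  have : ∀ t, Real.exp (-θ * t) ^ 2 = Real.exp (-(2 * θ) * t) := by
    intro t
    rw [← Real.exp_nat_mul]
    congr 1
    push_cast
    ring
  simp only [this]
  rw [integral_exp_mul_Ioi (by linarith)]
  rw [neg_div_neg_eq]
  ring_nf

/-- The form ρκ² matters: it does not change when ρ is multiplied by N and κ by N^(-1/2). -/
theorem expTail_cosh_le (hθ : 0 < θ) {ρ : ℝ} (hρ : 0 ≤ ρ) (κ : ℝ) :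
    expTail ρ (fun t => Real.cosh (κ * Real.exp (-θ * t))) 0 ≤
      Real.exp (ρ * κ ^ 2 * (Real.exp (κ ^ 2 / 2) / (4 * θ))) := by
  have h : ∫ t in Set.Ioi 0, (Real.cosh (κ * Real.exp (-θ * t)) - 1) ≤
      ∫ t in Set.Ioi 0, κ ^ 2 / 2 * Real.exp (κ ^ 2 / 2) * Real.exp (-θ * t) ^ 2 := by
    refine setIntegral_mono_on (integrableOn_cosh_exp_sub_one hθ κ 0)
      ((integrableOn_exp_neg_two_mul hθ 0).const_mul _) measurableSet_Ioi fun t ht => ?_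
    refine (le_abs_self _).trans ((abs_cosh_exp_sub_one_le hθ κ (le_of_lt ht)).trans ?_)
    simp
  rw [integral_const_mul, integral_exp_neg_two_mul hθ, mul_zero, Real.exp_zero] at h
  refine Real.exp_le_exp.2 ((mul_le_mul_of_nonneg_left h hρ).trans (le_of_eq ?_))
  field_simp
  norm_num

variable {δ : ℝ} (hδ : 0 < δ)

theorem lintegral_cosh_jump_le (v : Sobolev (-1 - δ)) (α : ℝ) :
    ∫⁻ m, ENNReal.ofReal (Real.cosh ‖v + (m.1 * α) • diracMass hδ m.2‖)
      ∂(signMeasure.prod torusMeasure) ≤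
      ENNReal.ofReal (Real.cosh ‖v‖ * Real.cosh (diracNorm δ * α)) := by
  have hd : Measurable (diracMass hδ) := (continuous_diracMass hδ).measurable
  have hcm := Real.continuous_cosh.measurable
  have hm : Measurable fun m : ℝ × Torus =>
      ENNReal.ofReal (Real.cosh ‖v + (m.1 * α) • diracMass hδ m.2‖) := by fun_prop
  have hm1 : Measurable fun x : Torus =>
      ENNReal.ofReal (Real.cosh ‖v + (1 * α) • diracMass hδ x‖) := by fun_prop
  rw [lintegral_prod _ hm.aemeasurable, lintegral_signMeasure]
  simp only
  rw [← lintegral_add_left hm1]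
  have hpt : ∀ x, ENNReal.ofReal (Real.cosh ‖v + (1 * α) • diracMass hδ x‖) +
      ENNReal.ofReal (Real.cosh ‖v + (-1 * α) • diracMass hδ x‖) ≤
      2 * ENNReal.ofReal (Real.cosh ‖v‖ * Real.cosh (diracNorm δ * α)) := by
    intro x
    rw [← ENNReal.ofReal_add (Real.cosh_pos _).le (Real.cosh_pos _).le]
    have h2 : (2 : ℝ≥0∞) = ENNReal.ofReal 2 := by simp
    rw [h2, ← ENNReal.ofReal_mul zero_le_two]
    refine ENNReal.ofReal_le_ofReal ?_
    have := cosh_norm_add_add_cosh_norm_sub_le v (α • diracMass hδ x)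
    have hα : Real.cosh (|α| * diracNorm δ) = Real.cosh (diracNorm δ * α) := by
      rw [← Real.cosh_abs (diracNorm δ * α), abs_mul, abs_of_nonneg (diracNorm_nonneg δ), mul_comm]
    rw [norm_smul, norm_diracMass, Real.norm_eq_abs, hα] at this
    simpa [sub_eq_add_neg] using this
  calc _ ≤ 2⁻¹ * ∫⁻ _, 2 * ENNReal.ofReal (Real.cosh ‖v‖ * Real.cosh (diracNorm δ * α))
        ∂torusMeasure := by gcongr with x; exact hpt x
    _ = _ := by
      rw [lintegral_const, measure_univ, mul_one, ← mul_assoc,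
        ENNReal.inv_mul_cancel two_ne_zero ENNReal.ofNat_ne_top, one_mul]

/-- The supermartingale step: averaging over the sign costs a factor of at most g at the new time,
and the renewal equation averages g times `expTail` back to `expTail`. -/
theorem lintegral_cosh_jumpStep_le (hθ : 0 < θ) {ρ : ℝ} (hρ : 0 < ρ) {c : ℝ} (hc : 0 ≤ c)
    (M : ℝ≥0∞) (e : ℝ × Sobolev (-1 - δ)) :
    ∫⁻ m, (fun e : ℝ × Sobolev (-1 - δ) => ENNReal.ofReal (Real.cosh ‖e.2‖ *
        expTail ρ (fun t => Real.cosh (diracNorm δ * c * Real.exp (-θ * t))) e.1))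
      (jumpStep hδ (fun t => c * decay θ M t) e m) ∂(markMeasure ρ) ≤
    ENNReal.ofReal (Real.cosh ‖e.2‖ *
        expTail ρ (fun t => Real.cosh (diracNorm δ * c * Real.exp (-θ * t))) e.1) := by
  set g : ℝ → ℝ := fun t => Real.cosh (diracNorm δ * c * Real.exp (-θ * t)) with hg
  have hgi : ∀ s, IntegrableOn (fun t => g t - 1) (Set.Ioi s) :=
    integrableOn_cosh_exp_sub_one hθ _
  have hgc : Continuous g := by
    have := Real.continuous_cosh
    fun_prop
  have hHm := (continuous_expTail (ρ := ρ) hgi).measurable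
  have hT : Measurable fun e : ℝ × Sobolev (-1 - δ) =>
      ENNReal.ofReal (Real.cosh ‖e.2‖ * expTail ρ g e.1) := by
    have := Real.continuous_cosh.measurable
    fun_prop
  have := isProbabilityMeasure_expMeasure hρ
  have hTm : Measurable fun m => (fun e : ℝ × Sobolev (-1 - δ) =>
      ENNReal.ofReal (Real.cosh ‖e.2‖ * expTail ρ g e.1))
        (jumpStep hδ (fun t => c * decay θ M t) e m) :=
    hT.comp ((measurable_jumpStep hδ ((measurable_decay θ M).const_mul c)).comp
      (measurable_prodMk_left (x := e)))
  obtain ⟨hi, hv⟩ := integral_expMeasure_expTail hρ hgi Set.countable_empty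
    (fun t _ => hgc.continuousAt) e.1
  have hnn : ∀ w, 0 ≤ g (e.1 + w) * expTail ρ g (e.1 + w) := fun w =>
    mul_nonneg (Real.cosh_pos _).le (expTail_pos _).le
  rw [markMeasure, lintegral_prod _ hTm.aemeasurable]
  calc _ ≤ ∫⁻ w, ENNReal.ofReal (Real.cosh ‖e.2‖) *
        ENNReal.ofReal (g (e.1 + w) * expTail ρ g (e.1 + w)) ∂(expMeasure ρ) := by
        refine lintegral_mono fun w => ?_
        simp only [jumpStep]
        simp only [ENNReal.ofReal_mul (Real.cosh_pos _).le]
        rw [lintegral_mul_const' _ _ ENNReal.ofReal_ne_top]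
        refine (mul_le_mul_left (lintegral_cosh_jump_le hδ _ _) _).trans ?_
        rw [← ENNReal.ofReal_mul (by positivity), ← ENNReal.ofReal_mul (by positivity),
          mul_assoc]
        refine ENNReal.ofReal_le_ofReal ?_
        -- Dropping the cut-off only increases g; it makes g continuous and the final bound
        -- independent of `M`.
        have hcosh : Real.cosh (diracNorm δ * (c * decay θ M (e.1 + w))) ≤ g (e.1 + w) := by
          refine Real.cosh_le_cosh.2 ?_
          have h0 := diracNorm_nonneg δ
          have h1 := decay_nonneg θ M (e.1 + w)
          have h2 := decay_le θ M (e.1 + w)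
          rw [abs_of_nonneg (by positivity), abs_of_nonneg (by positivity), ← mul_assoc]
          gcongr
        have := (expTail_pos (ρ := ρ) (g := g) (e.1 + w)).le
        gcongr
    _ = ENNReal.ofReal (Real.cosh ‖e.2‖ * expTail ρ g e.1) := by
        rw [lintegral_const_mul' _ _ ENNReal.ofReal_ne_top,
          ← ofReal_integral_eq_lintegral_ofReal hi (ae_of_all _ hnn), hv,
          ENNReal.ofReal_mul (Real.cosh_pos _).le]

/-- Fatou's lemma along the chain: `expTail` tends to 1 while the partial sums converge. -/
theorem lintegral_cosh_vortexSum_le (hθ : 0 < θ) {ρ : ℝ} (hρ : 0 < ρ) {c : ℝ} (hc : 0 ≤ c)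
    (M : ℝ≥0∞) :
    ∫⁻ z, ENNReal.ofReal (Real.cosh ‖c • vortexSum hδ θ M z‖) ∂(sampleMeasure ρ) ≤
      ENNReal.ofReal (expTail ρ (fun t => Real.cosh (diracNorm δ * c * Real.exp (-θ * t))) 0) := by
  set g : ℝ → ℝ := fun t => Real.cosh (diracNorm δ * c * Real.exp (-θ * t)) with hg
  have hgi : ∀ s, IntegrableOn (fun t => g t - 1) (Set.Ioi s) :=
    integrableOn_cosh_exp_sub_one hθ _
  have hHm := (continuous_expTail (ρ := ρ) hgi).measurable
  have hcm := Real.continuous_cosh.measurable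
  have hT : Measurable fun e : ℝ × Sobolev (-1 - δ) =>
      ENNReal.ofReal (Real.cosh ‖e.2‖ * expTail ρ g e.1) := by fun_prop
  have := isProbabilityMeasure_markMeasure hρ
  have hstep := measurable_jumpStep hδ ((measurable_decay θ M).const_mul c)
  set S := fun (n : ℕ) (z : ℕ → ℝ × ℝ × Torus) =>
    markovState (jumpStep hδ fun t => c * decay θ M t) (0, 0) z n with hS
  have hSm : ∀ n, Measurable (S n) := fun n =>
    (measurable_markovState hstep n).comp measurable_prodMk_left
  have hle : ∀ n, ∫⁻ z, ENNReal.ofReal (Real.cosh ‖(S n z).2‖ * expTail ρ g (S n z).1)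
      ∂(sampleMeasure ρ) ≤ ENNReal.ofReal (expTail ρ g 0) := by
    intro n
    have h := lintegral_markovState_le (markMeasure ρ) hstep hT (q := 1) (fun e => by
      rw [one_mul]; exact lintegral_cosh_jumpStep_le hδ hθ hρ hc M e) n (0, 0)
    rw [one_pow, one_mul, norm_zero, Real.cosh_zero, one_mul] at h
    exact h
  have hae : ∀ᵐ z ∂(sampleMeasure ρ), ENNReal.ofReal (Real.cosh ‖c • vortexSum hδ θ M z‖) =
      liminf (fun n => ENNReal.ofReal (Real.cosh ‖(S n z).2‖ * expTail ρ g (S n z).1)) atTop := by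
    filter_upwards [ae_tendsto_markovState hδ hρ hθ c M] with z hz
    have h1 := ((Real.continuous_cosh.tendsto _).comp hz.2.norm).mul
      ((tendsto_expTail_atTop (ρ := ρ) (g := g)).comp hz.1)
    rw [mul_one] at h1
    exact ((ENNReal.tendsto_ofReal h1).liminf_eq).symm
  rw [lintegral_congr_ae hae]
  refine (lintegral_liminf_le fun n => hT.comp (hSm n)).trans ?_
  refine liminf_le_of_le (by isBoundedDefault) fun b hb => ?_
  obtain ⟨n, hn⟩ := hb.exists
  exact hn.trans (hle n)

/-- A bound for the exponential moments of the laws, uniform in the time and in the intensity. -/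
noncomputable def momentBound (θ lam δ : ℝ) : ℝ :=
  Real.exp (lam * diracNorm δ ^ 2 * (Real.exp (diracNorm δ ^ 2 / 2) / (4 * θ)))

theorem lintegral_cosh_vortexLaw_le (hθ : 0 < θ) {lam : ℝ} (hlam : 0 < lam) (M : ℝ≥0∞)
    (N : Set.Ici (1 : ℝ)) :
    ∫⁻ u, ENNReal.ofReal (Real.cosh ‖u‖) ∂(vortexLaw hδ θ hlam M N : Measure (Sobolev (-1 - δ))) ≤
      ENNReal.ofReal (momentBound θ lam δ) := by
  have hN1 : (1 : ℝ) ≤ N := N.2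
  have hN : (0 : ℝ) < N := zero_lt_one.trans_le hN1
  have hcm := Real.continuous_cosh.measurable
  have hm : Measurable fun u : Sobolev (-1 - δ) => ENNReal.ofReal (Real.cosh ‖u‖) := by fun_prop
  have hlaw : (vortexLaw hδ θ hlam M N : Measure (Sobolev (-1 - δ))) =
      (sampleMeasure (N * lam)).map fun z => (√(N : ℝ))⁻¹ • vortexSum hδ θ M z := rfl
  have hXm : Measurable fun z => (√(N : ℝ))⁻¹ • vortexSum hδ θ M z :=
    (measurable_vortexSum hδ θ M).const_smul (√(N : ℝ))⁻¹
  rw [hlaw, lintegral_map hm hXm]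
  refine (lintegral_cosh_vortexSum_le hδ hθ (mul_pos hN hlam) (by positivity) M).trans
    (ENNReal.ofReal_le_ofReal ?_)
  refine (expTail_cosh_le hθ (by positivity) _).trans (Real.exp_le_exp.2 ?_)
  have hsq : (diracNorm δ * (√(N : ℝ))⁻¹) ^ 2 = diracNorm δ ^ 2 / N := by
    rw [mul_pow, inv_pow, Real.sq_sqrt hN.le, div_eq_mul_inv]
  rw [hsq]
  -- N ≥ 1 serves only for the inner exponential; in the prefactor N cancels exactly.
  have h1 : diracNorm δ ^ 2 / N ≤ diracNorm δ ^ 2 := div_le_self (sq_nonneg _) hN1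
  have h2 : N * lam * (diracNorm δ ^ 2 / N) = lam * diracNorm δ ^ 2 := by
    field_simp
  rw [h2]
  gcongr

end ExpMoment

/-! ### The characteristic functional -/

section CharFunctional

variable {θ δ : ℝ} (hδ : 0 < δ)

theorem order_add_eq_zero (δ : ℝ) : (-1 - δ) + (1 + δ) = 0 := by ring

theorem continuous_pairing_diracMass (h : Sobolev (1 + δ)) :
    Continuous fun x => pairing (diracMass hδ x) h :=
  (continuous_pairing_left (order_add_eq_zero δ) h).comp (continuous_diracMass hδ)

theorem abs_pairing_diracMass_le (h : Sobolev (1 + δ)) (x : Torus) :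
    |pairing (diracMass hδ x) h| ≤ diracNorm δ * ‖h‖ := by
  rw [← norm_diracMass hδ x]
  exact abs_pairing_le (order_add_eq_zero δ) _ _

/-- The characteristic function of the coupling with `h` of a random signed Dirac mass at a
uniform point. -/
noncomputable def meanCos (h : Sobolev (1 + δ)) (α : ℝ) : ℝ :=
  ∫ x, Real.cos (α * pairing (diracMass hδ x) h) ∂torusMeasure

theorem continuous_meanCos (h : Sobolev (1 + δ)) : Continuous (meanCos hδ h) := by
  have hp := continuous_pairing_diracMass hδ h
  refine continuous_of_dominated (bound := fun _ => 1)
    (fun α => Continuous.aestronglyMeasurable (by fun_prop))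
    (fun α => ae_of_all _ fun x => Real.abs_cos_le_one _) (integrable_const _)
    (ae_of_all _ fun x => by fun_prop)

theorem integrable_cos_pairing (h : Sobolev (1 + δ)) (α : ℝ) :
    Integrable (fun x => Real.cos (α * pairing (diracMass hδ x) h)) torusMeasure := by
  have hp := continuous_pairing_diracMass hδ h
  exact Integrable.of_bound (C := 1) (Continuous.aestronglyMeasurable (by fun_prop))
    (ae_of_all _ fun x => Real.abs_cos_le_one _)

theorem meanCos_le_one (h : Sobolev (1 + δ)) (α : ℝ) : meanCos hδ h α ≤ 1 := by
  calc meanCos hδ h α ≤ ∫ _ : Torus, (1 : ℝ) ∂torusMeasure :=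
        integral_mono (integrable_cos_pairing hδ h α) (integrable_const _)
          fun x => Real.cos_le_one _
    _ = 1 := by simp

theorem meanCos_sub_one (h : Sobolev (1 + δ)) (α : ℝ) : meanCos hδ h α - 1 =
    ∫ x, (Real.cos (α * pairing (diracMass hδ x) h) - 1) ∂torusMeasure := by
  rw [integral_sub (integrable_cos_pairing hδ h α) (integrable_const _)]
  simp [meanCos]

theorem abs_cos_sub_one_le (y : ℝ) : |Real.cos y - 1| ≤ y ^ 2 / 2 := by
  rw [abs_sub_comm, abs_of_nonneg (sub_nonneg.2 (Real.cos_le_one y))]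
  linarith [Real.one_sub_sq_div_two_le_cos (x := y)]

theorem abs_cos_mul_pairing_sub_one_le (h : Sobolev (1 + δ)) (α : ℝ) (x : Torus) :
    |Real.cos (α * pairing (diracMass hδ x) h) - 1| ≤ α ^ 2 * ((diracNorm δ * ‖h‖) ^ 2 / 2) := by
  refine (abs_cos_sub_one_le _).trans ?_
  rw [mul_pow, mul_div_assoc]
  have : pairing (diracMass hδ x) h ^ 2 ≤ (diracNorm δ * ‖h‖) ^ 2 :=
    sq_le_sq.2 ((abs_pairing_diracMass_le hδ h x).trans (le_abs_self _))
  gcongr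

theorem abs_meanCos_sub_one_le (h : Sobolev (1 + δ)) (α : ℝ) :
    |meanCos hδ h α - 1| ≤ α ^ 2 * ((diracNorm δ * ‖h‖) ^ 2 / 2) := by
  rw [meanCos_sub_one, ← Real.norm_eq_abs]
  refine (norm_integral_le_of_norm_le_const (ae_of_all _ fun x =>
    abs_cos_mul_pairing_sub_one_le hδ h α x)).trans (le_of_eq ?_)
  simp

theorem sq_mul_decay_le (c : ℝ) (M : ℝ≥0∞) (t : ℝ) :
    (c * decay θ M t) ^ 2 ≤ c ^ 2 * Real.exp (-θ * t) ^ 2 := by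
  rw [mul_pow]
  have h1 := decay_le θ M t
  have h0 := decay_nonneg θ M t
  gcongr

theorem integrableOn_meanCos_sub_one (hθ : 0 < θ) (h : Sobolev (1 + δ)) (c : ℝ) (M : ℝ≥0∞) (s : ℝ) :
    IntegrableOn (fun t => meanCos hδ h (c * decay θ M t) - 1) (Set.Ioi s) := by
  have hm : Measurable fun t => meanCos hδ h (c * decay θ M t) - 1 :=
    ((continuous_meanCos hδ h).measurable.comp ((measurable_decay θ M).const_mul c)).sub_const 1
  refine Integrable.mono' (((integrableOn_exp_neg_two_mul hθ s).const_mul (c ^ 2)).mul_const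
    ((diracNorm δ * ‖h‖) ^ 2 / 2)) hm.aestronglyMeasurable (ae_of_all _ fun t => ?_)
  refine (abs_meanCos_sub_one_le hδ h _).trans ?_
  have := sq_mul_decay_le (θ := θ) c M t
  gcongr

/-- For `M = ∞` the default `M.toReal = 0` excludes a point where continuity holds anyway. -/
theorem continuousAt_decay {M : ℝ≥0∞} {t : ℝ} (ht : t ≠ M.toReal) :
    ContinuousAt (decay θ M) t := by
  have hexp : ContinuousAt (fun t => Real.exp (-θ * t)) t := by fun_prop
  by_cases hM : M = ∞
  · refine hexp.congr (.of_forall fun u => ?_)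
    simp [decay, hM]
  rcases lt_or_gt_of_ne ht with h | h
  · refine hexp.congr ?_
    filter_upwards [Iio_mem_nhds h] with u hu
    rw [decay, if_pos ((ENNReal.ofReal_le_iff_le_toReal hM).2 (le_of_lt hu))]
  · refine (continuousAt_const (y := (0 : ℝ))).congr ?_
    filter_upwards [Ioi_mem_nhds h] with u hu
    rw [decay, if_neg fun hle => not_le_of_gt hu ((ENNReal.ofReal_le_iff_le_toReal hM).1 hle)]

theorem integral_signMeasure (f : ℝ → ℂ) : ∫ σ, f σ ∂signMeasure = 2⁻¹ * (f 1 + f (-1)) := by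
  rw [signMeasure, integral_smul_measure, integral_add_measure (integrable_dirac (by simp))
    (integrable_dirac (by simp)), integral_dirac, integral_dirac]
  simp
  ring

theorem integral_cexp_pairing_jump (h : Sobolev (1 + δ)) (α : ℝ) :
    ∫ m : ℝ × Torus, Complex.exp (((m.1 * α * pairing (diracMass hδ m.2) h : ℝ) : ℂ) * Complex.I)
      ∂(signMeasure.prod torusMeasure) = meanCos hδ h α := by
  have hp := continuous_pairing_diracMass hδ h
  have hp2 : Continuous fun m : ℝ × Torus => pairing (diracMass hδ m.2) h := hp.comp continuous_snd
  have hint : ∀ β : ℝ, Integrable (fun x =>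
      Complex.exp (((β * pairing (diracMass hδ x) h : ℝ) : ℂ) * Complex.I)) torusMeasure :=
    fun β => Integrable.of_bound (C := 1) (Continuous.aestronglyMeasurable (by fun_prop))
      (ae_of_all _ fun x => by rw [Complex.norm_exp_ofReal_mul_I])
  rw [integral_prod _ (Integrable.of_bound (C := 1) (Continuous.aestronglyMeasurable
    (by fun_prop)) (ae_of_all _ fun x => by rw [Complex.norm_exp_ofReal_mul_I])),
    integral_signMeasure, ← integral_add (by simpa using hint α) (by simpa using hint (-α)),
    ← integral_const_mul, meanCos, ← integral_complex_ofReal]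
  refine integral_congr_ae (ae_of_all _ fun x => ?_)
  simp only
  rw [Complex.ofReal_cos, Complex.cos]
  push_cast
  ring_nf

/-- The exponential of `i` times the coupling with `h`, corrected by the contribution of the jumps
yet to come. -/
noncomputable def jumpChar (ρ θ c : ℝ) (M : ℝ≥0∞) (h : Sobolev (1 + δ))
    (e : ℝ × Sobolev (-1 - δ)) : ℂ :=
  (expTail ρ (fun t => meanCos hδ h (c * decay θ M t)) e.1 : ℝ) *
    Complex.exp ((pairing e.2 h : ℝ) * Complex.I)

theorem measurable_jumpChar (hθ : 0 < θ) (ρ c : ℝ) (M : ℝ≥0∞) (h : Sobolev (1 + δ)) :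
    Measurable (jumpChar hδ ρ θ c M h) := by
  have h1 := (continuous_expTail (ρ := ρ) (integrableOn_meanCos_sub_one hδ hθ h c M)).measurable
  have h2 := (continuous_pairing_left (order_add_eq_zero δ) h).measurable
  unfold jumpChar
  fun_prop

/-- The exponent of `expTail` is nonpositive because `meanCos` is at most 1. This bound allows
dominated convergence along the chain. -/
theorem norm_jumpChar_le {ρ : ℝ} (hρ : 0 < ρ) (c : ℝ) (M : ℝ≥0∞) (h : Sobolev (1 + δ))
    (e : ℝ × Sobolev (-1 - δ)) : ‖jumpChar hδ ρ θ c M h e‖ ≤ 1 := by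
  rw [jumpChar, norm_mul, Complex.norm_exp_ofReal_mul_I, mul_one, Complex.norm_real,
    Real.norm_of_nonneg (expTail_pos _).le, expTail, Real.exp_le_one_iff]
  refine mul_nonpos_of_nonneg_of_nonpos hρ.le (integral_nonpos fun t => ?_)
  exact sub_nonpos.2 (meanCos_le_one hδ h _)

/-- The martingale step: averaging over sign and position produces the factor `meanCos`, and the
renewal equation over the waiting time restores `expTail`. -/
theorem integral_jumpChar_jumpStep (hθ : 0 < θ) {ρ : ℝ} (hρ : 0 < ρ) (c : ℝ) (M : ℝ≥0∞)
    (h : Sobolev (1 + δ)) (e : ℝ × Sobolev (-1 - δ)) :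
    ∫ m, jumpChar hδ ρ θ c M h (jumpStep hδ (fun t => c * decay θ M t) e m) ∂(markMeasure ρ) =
      jumpChar hδ ρ θ c M h e := by
  have := isProbabilityMeasure_expMeasure hρ
  have hrs := order_add_eq_zero δ
  set g : ℝ → ℝ := fun t => meanCos hδ h (c * decay θ M t) with hg
  have hm : Measurable fun m =>
      jumpChar hδ ρ θ c M h (jumpStep hδ (fun t => c * decay θ M t) e m) :=
    (measurable_jumpChar hδ hθ ρ c M h).comp
      ((measurable_jumpStep hδ ((measurable_decay θ M).const_mul c)).comp
        (measurable_prodMk_left (x := e)))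
  have hc : ∀ t ∉ ({M.toReal} : Set ℝ), ContinuousAt g t := fun t ht =>
    (continuous_meanCos hδ h).continuousAt.comp
      (continuousAt_const.mul (continuousAt_decay ht))
  obtain ⟨-, hv⟩ := integral_expMeasure_expTail hρ (integrableOn_meanCos_sub_one hδ hθ h c M)
    (Set.countable_singleton _) hc e.1
  rw [markMeasure, integral_prod _ (Integrable.of_bound (C := 1) hm.aestronglyMeasurable
    (ae_of_all _ fun m => norm_jumpChar_le hδ hρ c M h _))]
  have hinner : ∀ w, ∫ m, jumpChar hδ ρ θ c M h (jumpStep hδ (fun t => c * decay θ M t) e (w, m))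
      ∂(signMeasure.prod torusMeasure) =
      ((g (e.1 + w) * expTail ρ g (e.1 + w) : ℝ) : ℂ) *
        Complex.exp ((pairing e.2 h : ℝ) * Complex.I) := by
    intro w
    have hpt : ∀ m : ℝ × Torus,
        jumpChar hδ ρ θ c M h (jumpStep hδ (fun t => c * decay θ M t) e (w, m)) =
        ((expTail ρ g (e.1 + w) : ℝ) : ℂ) * Complex.exp ((pairing e.2 h : ℝ) * Complex.I) *
          Complex.exp (((m.1 * (c * decay θ M (e.1 + w)) * pairing (diracMass hδ m.2) h : ℝ) : ℂ) *
            Complex.I) := by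
      intro m
      rw [jumpChar, jumpStep, pairing_add_left hrs, pairing_smul_left hrs, Complex.ofReal_add,
        add_mul, Complex.exp_add]
      exact (mul_assoc _ _ _).symm
    simp only [hpt]
    rw [integral_const_mul, integral_cexp_pairing_jump]
    simp only [hg]
    push_cast
    ring
  simp only [hinner]
  rw [integral_mul_const, integral_complex_ofReal, hv, jumpChar]

/-- The characteristic functional of the Poissonian random distribution. -/
theorem integral_cexp_pairing_vortexSum (hθ : 0 < θ) {ρ : ℝ} (hρ : 0 < ρ) (c : ℝ) (M : ℝ≥0∞)
    (h : Sobolev (1 + δ)) :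
    ∫ z, Complex.exp ((pairing (c • vortexSum hδ θ M z) h : ℝ) * Complex.I) ∂(sampleMeasure ρ) =
      (expTail ρ (fun t => meanCos hδ h (c * decay θ M t)) 0 : ℝ) := by
  have := isProbabilityMeasure_markMeasure hρ
  have := isProbabilityMeasure_sampleMeasure hρ
  have hrs := order_add_eq_zero δ
  have hstep := measurable_jumpStep hδ ((measurable_decay θ M).const_mul c)
  have hTm := measurable_jumpChar hδ hθ ρ c M h
  have hconst := integral_markovState_eq (markMeasure ρ) hstep hTm
    (norm_jumpChar_le hδ hρ c M h) (integral_jumpChar_jumpStep hδ hθ hρ c M h)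
  have hlim := tendsto_integral_of_dominated_convergence (μ := sampleMeasure ρ)
    (F := fun n z => jumpChar hδ ρ θ c M h
      (markovState (jumpStep hδ fun t => c * decay θ M t) (0, 0) z n))
    (f := fun z => Complex.exp ((pairing (c • vortexSum hδ θ M z) h : ℝ) * Complex.I))
    (fun _ => (1 : ℝ)) (fun n => (hTm.comp ((measurable_markovState hstep n).comp
      measurable_prodMk_left)).aestronglyMeasurable) (integrable_const _)
    (fun n => ae_of_all _ fun z => norm_jumpChar_le hδ hρ c M h _) ?_
  -- The expectations are constant in `n`, equal to the value at the initial state, so the limit is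
  -- too.
  · refine tendsto_nhds_unique hlim (tendsto_const_nhds.congr fun n => ?_)
    refine Eq.trans ?_ (hconst n (0, 0)).symm
    have h0 : pairing (0 : Sobolev (-1 - δ)) h = 0 := by
      simpa using pairing_smul_left hrs 0 (0 : Sobolev (-1 - δ)) h
    simp [jumpChar, h0]
  · filter_upwards [ae_tendsto_markovState hδ hρ hθ c M] with z hz
    have h1 := (tendsto_expTail_atTop (ρ := ρ)
      (g := fun t => meanCos hδ h (c * decay θ M t))).comp hz.1
    have h2 := ((continuous_pairing_left hrs h).tendsto _).comp hz.2
    have h3 := ((Complex.continuous_ofReal.tendsto _).comp h1).mul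
      ((Complex.continuous_exp.tendsto _).comp
        (((Complex.continuous_ofReal.tendsto _).comp h2).mul_const Complex.I))
    rw [Complex.ofReal_one, one_mul] at h3
    exact h3

/-! ### The Gaussian limit of the characteristic functional -/

theorem tendsto_mul_cos_sub_one (y : ℝ) :
    Tendsto (fun N : ℝ => N * (Real.cos ((√N)⁻¹ * y) - 1)) atTop (𝓝 (-(y ^ 2 / 2))) := by
  rw [tendsto_iff_norm_sub_tendsto_zero]
  -- The constant 5/96 is that of `Real.cos_bound`, which needs |x| ≤ 1, that is N ≥ y².
  have hlim : Tendsto (fun N : ℝ => y ^ 4 * (5 / 96) / N) atTop (𝓝 0) :=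
    tendsto_const_nhds.div_atTop tendsto_id
  refine squeeze_zero' (.of_forall fun _ => norm_nonneg _) ?_ hlim
  filter_upwards [eventually_ge_atTop (y ^ 2), eventually_gt_atTop 0] with N hN hN0
  set x := (√N)⁻¹ * y with hx
  have hx2 : x ^ 2 = y ^ 2 / N := by
    rw [hx, mul_pow, inv_pow, Real.sq_sqrt hN0.le]; ring
  have hx1 : |x| ≤ 1 := by
    rw [← sq_le_one_iff_abs_le_one, hx2, div_le_one hN0]
    exact hN
  have hb := Real.cos_bound hx1
  have h4 : |x| ^ 4 = y ^ 4 / N ^ 2 := by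
    rw [show |x| ^ 4 = (|x| ^ 2) ^ 2 by ring, sq_abs, hx2]; ring
  rw [h4] at hb
  have : N * (Real.cos x - 1) - -(y ^ 2 / 2) = N * (Real.cos x - (1 - x ^ 2 / 2)) := by
    rw [hx2]; field_simp; ring
  rw [this, norm_mul, Real.norm_of_nonneg hN0.le, Real.norm_eq_abs]
  refine (mul_le_mul_of_nonneg_left hb hN0.le).trans (le_of_eq ?_)
  field_simp

/-- The quadratic bound on 1 - cos dominates uniformly, as N cancels the squared amplitude; the
limit is evaluated by Parseval. -/
theorem tendsto_mul_meanCos_sub_one (h : Sobolev (1 + δ)) (α : ℝ) :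
    Tendsto (fun N : ℝ => N * (meanCos hδ h ((√N)⁻¹ * α) - 1)) atTop
      (𝓝 (-(α ^ 2 * (l2NormSq h / 2)))) := by
  have hp := continuous_pairing_diracMass hδ h
  have hval : ∫ x, -((α * pairing (diracMass hδ x) h) ^ 2 / 2) ∂torusMeasure =
      -(α ^ 2 * (l2NormSq h / 2)) := by
    simp only [mul_pow, mul_div_assoc]
    rw [integral_neg, integral_const_mul, integral_div, integral_pairing_diracMass_sq]
  simp only [meanCos_sub_one, ← integral_const_mul]
  rw [← hval]
  refine tendsto_integral_filter_of_dominated_convergence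
    (fun _ => α ^ 2 * ((diracNorm δ * ‖h‖) ^ 2 / 2))
    (.of_forall fun N => Continuous.aestronglyMeasurable (by fun_prop)) ?_ (integrable_const _)
    (ae_of_all _ fun x => ?_)
  · filter_upwards [eventually_gt_atTop 0] with N hN
    refine ae_of_all _ fun x => ?_
    rw [norm_mul, Real.norm_of_nonneg hN.le, Real.norm_eq_abs]
    refine (mul_le_mul_of_nonneg_left (abs_cos_mul_pairing_sub_one_le hδ h _ x) hN.le).trans
      (le_of_eq ?_)
    rw [mul_pow, inv_pow, Real.sq_sqrt hN.le]
    field_simp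
  · simpa only [mul_assoc] using tendsto_mul_cos_sub_one (α * pairing (diracMass hδ x) h)

theorem integral_decay_sq (hθ : 0 < θ) (M : ℝ≥0∞) :
    ∫ t in Set.Ioi 0, decay θ M t ^ 2 =
      (1 - if M = ∞ then 0 else Real.exp (-2 * θ * M.toReal)) / (2 * θ) := by
  have h0 := integral_exp_neg_two_mul hθ 0
  rw [mul_zero, Real.exp_zero] at h0
  by_cases hM : M = ∞
  · rw [if_pos hM, sub_zero, ← h0]
    simp [decay, hM]
  · rw [if_neg hM, sub_div, ← h0, ← integral_exp_neg_two_mul hθ]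
    have hsub : Set.Ioi M.toReal ⊆ Set.Ioi 0 := Set.Ioi_subset_Ioi ENNReal.toReal_nonneg
    have hind : ∀ t, decay θ M t ^ 2 = Real.exp (-θ * t) ^ 2 -
        (Set.Ioi M.toReal).indicator (fun t => Real.exp (-θ * t) ^ 2) t := by
      intro t
      rw [decay]
      by_cases ht : t ≤ M.toReal
      · rw [if_pos ((ENNReal.ofReal_le_iff_le_toReal hM).2 ht),
          Set.indicator_of_notMem (by simpa using ht), sub_zero]
      · rw [if_neg fun hle => ht ((ENNReal.ofReal_le_iff_le_toReal hM).1 hle),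
          Set.indicator_of_mem (by simpa using ht), sub_self]
        norm_num
    have hi := integrableOn_exp_neg_two_mul hθ 0
    simp only [hind]
    rw [integral_sub hi (hi.indicator measurableSet_Ioi), integral_indicator measurableSet_Ioi,
      Measure.restrict_restrict measurableSet_Ioi, Set.inter_eq_left.2 hsub]

theorem tendsto_expTail_meanCos (hθ : 0 < θ) (lam : ℝ) (M : ℝ≥0∞) (h : Sobolev (1 + δ)) :
    Tendsto (fun N : ℝ => expTail (N * lam) (fun t => meanCos hδ h ((√N)⁻¹ * decay θ M t)) 0) atTop
      (𝓝 (Real.exp (-(limitVariance θ lam M * l2NormSq h / 2)))) := by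
  have hint : Tendsto (fun N : ℝ => ∫ t in Set.Ioi 0,
      N * (meanCos hδ h ((√N)⁻¹ * decay θ M t) - 1)) atTop
      (𝓝 (∫ t in Set.Ioi 0, -(decay θ M t ^ 2 * (l2NormSq h / 2)))) := by
    refine tendsto_integral_filter_of_dominated_convergence
      (fun t => Real.exp (-θ * t) ^ 2 * ((diracNorm δ * ‖h‖) ^ 2 / 2))
      (.of_forall fun N => ?_) ?_ ((integrableOn_exp_neg_two_mul hθ 0).mul_const _)
      (ae_of_all _ fun t => tendsto_mul_meanCos_sub_one hδ h _)
    · exact (integrableOn_meanCos_sub_one hδ hθ h _ M 0).aestronglyMeasurable.const_mul N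
    · filter_upwards [eventually_gt_atTop 0] with N hN
      refine ae_of_all _ fun t => ?_
      rw [norm_mul, Real.norm_of_nonneg hN.le, Real.norm_eq_abs]
      calc _ ≤ N * (((√N)⁻¹ * decay θ M t) ^ 2 * ((diracNorm δ * ‖h‖) ^ 2 / 2)) :=
            mul_le_mul_of_nonneg_left (abs_meanCos_sub_one_le hδ h _) hN.le
        _ ≤ N * ((√N)⁻¹ ^ 2 * Real.exp (-θ * t) ^ 2 * ((diracNorm δ * ‖h‖) ^ 2 / 2)) := by
            have := sq_mul_decay_le (θ := θ) (√N)⁻¹ M t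
            gcongr
        _ = _ := by
            rw [inv_pow, Real.sq_sqrt hN.le]
            field_simp
  have hval : lam * ∫ t in Set.Ioi 0, -(decay θ M t ^ 2 * (l2NormSq h / 2)) =
      -(limitVariance θ lam M * l2NormSq h / 2) := by
    rw [integral_neg, integral_mul_const, integral_decay_sq hθ, limitVariance]
    ring
  rw [← hval]
  refine ((Real.continuous_exp.tendsto _).comp (hint.const_mul lam)).congr fun N => ?_
  rw [Function.comp_apply, expTail, integral_const_mul]
  congr 1
  ring

end CharFunctional

/-! ### Tightness -/

section Tightness

theorem tendsto_weight_cofinite {s : ℝ} (hs : s < 0) : Tendsto (weight s) cofinite (𝓝 0) := by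
  have h1 : Tendsto (weight (-2)) cofinite (𝓝 0) := by
    have := (summable_weight one_pos).tendsto_cofinite_zero
    rwa [show (-1 - 1 : ℝ) = -2 by norm_num] at this
  -- Every negative order is a positive power of order -2, whose weights are summable.
  have h2 := h1.rpow_const (p := -s / 2) (Or.inr (by linarith))
  rw [Real.zero_rpow (by linarith)] at h2
  refine h2.congr fun k => ?_
  rw [weight, weight, ← Real.rpow_mul (base_pos k).le]
  congr 1
  ring

theorem abs_weight_le_one {s : ℝ} (hs : s ≤ 0) (k : Fin 2 → ℤ) : |weight s k| ≤ 1 := by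
  rw [abs_of_nonneg (weight_pos s k).le]
  refine Real.rpow_le_one_of_one_le_of_nonpos ?_ hs
  linarith [show 0 ≤ ∑ i, (k i : ℝ) ^ 2 by positivity]

/-- The embedding of `H^(-1-δ/2)` into `H^(-1-δ)`, seen in `ℓ²`. -/
noncomputable def embedding {δ : ℝ} (hδ : 0 < δ) :
    lp (fun _ : Fin 2 → ℤ => ℂ) 2 →L[ℝ] lp (fun _ : Fin 2 → ℤ => ℂ) 2 :=
  -- The exponent is the difference of the half-orders, (-1-δ)/2 - (-1-δ/2)/2.
  diagonal (weight (-δ / 4)) 1 (abs_weight_le_one (by linarith))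

variable {θ δ : ℝ} (hδ : 0 < δ)

theorem embedding_toLp_diracMass (x : Torus) :
    embedding hδ (Sobolev.toLp _ (diracMass (half_pos hδ) x)) =
      Sobolev.toLp _ (diracMass hδ x) := by
  refine Subtype.ext (funext fun k => ?_)
  change weight (-δ / 4) k • (weight ((-1 - δ / 2) / 2) k • UnitAddTorus.mFourier (-k) x) =
    weight ((-1 - δ) / 2) k • UnitAddTorus.mFourier (-k) x
  rw [smul_smul, weight_mul_weight]
  congr 2
  ring

/-- The two sums are taken in different spaces; they agree where both series converge, by continuity
of the embedding and agreement on Dirac masses. -/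
theorem ae_embedding_toLp_vortexSum (hθ : 0 < θ) {ρ : ℝ} (hρ : 0 < ρ) (c : ℝ) (M : ℝ≥0∞) :
    ∀ᵐ z ∂(sampleMeasure ρ),
      embedding hδ (Sobolev.toLp _ (c • vortexSum (half_pos hδ) θ M z)) =
        Sobolev.toLp _ (c • vortexSum hδ θ M z) := by
  filter_upwards [ae_abs_jumpSign hρ, ae_summable_exp_jumpTime hρ hθ] with z hs hz
  have hd : ∀ t, |decay θ M t| ≤ 1 * Real.exp (-θ * t) := fun t => by
    simpa using abs_mul_decay_le zero_le_one M t
  have h1 := ((summable_jump hδ hs hz hd).hasSum).map (Sobolev.toLp (-1 - δ))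
    (Sobolev.isometry_toLp _).continuous
  have h2 := (((summable_jump (half_pos hδ) hs hz hd).hasSum).map (Sobolev.toLp (-1 - δ / 2))
    (Sobolev.isometry_toLp _).continuous).mapL (embedding hδ)
  rw [← vortexSum_eq] at h1 h2
  rw [map_smul, map_smul, map_smul]
  congr 1
  refine h2.unique ?_
  convert h1 using 2 with i
  rw [Function.comp_apply, Function.comp_apply, map_smul, map_smul, map_smul,
    embedding_toLp_diracMass]

/-- Markov's inequality for cosh‖u‖ ≥ ‖u‖. -/
theorem exists_vortexLaw_norm_le (hθ : 0 < θ) {lam : ℝ} (hlam : 0 < lam) {ε : ℝ≥0∞} (hε : 0 < ε) :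
    ∃ n : ℕ, ∀ (M : ℝ≥0∞) (N : Set.Ici (1 : ℝ)),
      (vortexLaw hδ θ hlam M N : Measure (Sobolev (-1 - δ))) {u | (n : ℝ) ≤ ‖u‖} ≤ ε := by
  obtain ⟨n, hn⟩ := ENNReal.exists_nat_mul_gt hε.ne'
    (ENNReal.ofReal_ne_top (r := momentBound θ lam δ))
  have hn0 : (n : ℝ≥0∞) ≠ 0 := by
    intro h0
    rw [h0, zero_mul] at hn
    exact not_lt_bot hn
  have hcm := Real.continuous_cosh.measurable
  have hm : Measurable fun u : Sobolev (-1 - δ) => ENNReal.ofReal (Real.cosh ‖u‖) := by fun_prop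
  refine ⟨n, fun M N => ?_⟩
  calc (vortexLaw hδ θ hlam M N : Measure (Sobolev (-1 - δ))) {u | (n : ℝ) ≤ ‖u‖}
      ≤ (vortexLaw hδ θ hlam M N : Measure (Sobolev (-1 - δ)))
        {u | (n : ℝ≥0∞) ≤ ENNReal.ofReal (Real.cosh ‖u‖)} := by
        refine measure_mono fun u (hu : (n : ℝ) ≤ ‖u‖) => ?_
        rw [Set.mem_ofPred_eq, ← ENNReal.ofReal_natCast]
        refine ENNReal.ofReal_le_ofReal (hu.trans ?_)
        have h1 := Real.add_one_le_exp ‖u‖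
        have h2 := Real.one_sub_le_exp_neg ‖u‖
        have h3 := Real.sinh_lt_cosh ‖u‖
        have h4 := Real.self_le_sinh_iff.2 (norm_nonneg u)
        linarith
    _ ≤ _ := meas_ge_le_lintegral_div hm.aemeasurable hn0 (ENNReal.natCast_ne_top n)
    _ ≤ ENNReal.ofReal (momentBound θ lam δ) / n := by
        gcongr
        exact lintegral_cosh_vortexLaw_le hδ hθ hlam M N
    _ ≤ ε := ENNReal.div_le_of_le_mul (by rw [mul_comm]; exact hn.le)

/-- A ball of H^(-1-δ/2) carries most of the mass uniformly in `M` and `N`, and its image in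
H^(-1-δ) is relatively compact. -/
theorem isTightMeasureSet_vortexLaw (hθ : 0 < θ) {lam : ℝ} (hlam : 0 < lam) :
    IsTightMeasureSet {μ : Measure (Sobolev (-1 - δ)) |
      ∃ (M : ℝ≥0∞) (N : Set.Ici (1 : ℝ)), μ = vortexLaw hδ θ hlam M N} := by
  rw [isTightMeasureSet_iff_exists_isCompact_measure_compl_le]
  intro ε hε
  obtain ⟨n, hn⟩ := exists_vortexLaw_norm_le (half_pos hδ) hθ hlam hε
  have hcomp : IsCompactOperator (embedding hδ) :=
    isCompactOperator_diagonal _ _ _ (tendsto_weight_cofinite (by linarith))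
  set K := closure (embedding hδ '' Metric.closedBall 0 n) with hK
  have hKc : IsCompact K := hcomp.isCompact_closure_image_closedBall n
  have hemb : IsClosedEmbedding (Sobolev.toLp (-1 - δ)) :=
    (Sobolev.isometry_toLp (-1 - δ)).isClosedEmbedding
  refine ⟨Sobolev.toLp (-1 - δ) ⁻¹' K, hemb.isCompact_preimage hKc, ?_⟩
  rintro _ ⟨M, N, rfl⟩
  have hN : (0 : ℝ) < N := zero_lt_one.trans_le N.2
  set c := (√(N : ℝ))⁻¹
  have hXm : Measurable fun z => c • vortexSum hδ θ M z := (measurable_vortexSum hδ θ M).const_smul c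
  have hXm2 : Measurable fun z => c • vortexSum (half_pos hδ) θ M z :=
    (measurable_vortexSum (half_pos hδ) θ M).const_smul c
  have hlaw : (vortexLaw hδ θ hlam M N : Measure (Sobolev (-1 - δ))) =
      (sampleMeasure (N * lam)).map fun z => c • vortexSum hδ θ M z := rfl
  have hlaw2 : (vortexLaw (half_pos hδ) θ hlam M N : Measure (Sobolev (-1 - δ / 2))) =
      (sampleMeasure (N * lam)).map fun z => c • vortexSum (half_pos hδ) θ M z := rfl
  have hKm : MeasurableSet (Sobolev.toLp (-1 - δ) ⁻¹' K)ᶜ :=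
    (hKc.isClosed.preimage hemb.continuous).measurableSet.compl
  have h2 := hn M N
  rw [hlaw2, Measure.map_apply hXm2 (measurableSet_le measurable_const measurable_norm)] at h2
  rw [hlaw, Measure.map_apply hXm hKm]
  refine (measure_mono_ae ?_).trans h2
  filter_upwards [ae_embedding_toLp_vortexSum hδ hθ (mul_pos hN hlam) c M] with z hz hzK
  by_contra hlt
  refine hzK ?_
  change Sobolev.toLp (-1 - δ) (c • vortexSum hδ θ M z) ∈ K
  rw [← hz]
  refine subset_closure ⟨_, ?_, rfl⟩
  rw [mem_closedBall_zero_iff]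
  exact (not_le.1 hlt).le

end Tightness

/-! ### Convergence as the time tends to infinity -/

section Time

variable {θ δ : ℝ} (hδ : 0 < δ)

/-- Each term is eventually constant in `M`, and all are dominated by one summable sequence. -/
theorem ae_tendsto_vortexSum (hθ : 0 < θ) {ρ : ℝ} (hρ : 0 < ρ) :
    ∀ᵐ z ∂(sampleMeasure ρ),
      Tendsto (fun M : ℝ≥0 => vortexSum hδ θ M z) atTop (𝓝 (vortexSum hδ θ ∞ z)) := by
  filter_upwards [ae_abs_jumpSign hρ, ae_summable_exp_jumpTime hρ hθ] with z hs hz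
  simp only [vortexSum_eq]
  have hd : ∀ (M : ℝ≥0∞) t, |decay θ M t| ≤ 1 * Real.exp (-θ * t) := fun M t => by
    simpa using abs_mul_decay_le zero_le_one M t
  refine tendsto_tsum_of_dominated_convergence ((hz.mul_left 1).mul_right (diracNorm δ))
    (fun i => ?_) (.of_forall fun M i => norm_jump_le hδ hs (hd M) i)
  refine tendsto_const_nhds.congr' ?_
  filter_upwards [eventually_ge_atTop (jumpTime z i).toNNReal] with M hM
  have h : ENNReal.ofReal (jumpTime z i) ≤ M := ENNReal.coe_le_coe.2 hM
  rw [decay, decay, if_pos h, if_pos le_top]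

theorem tendsto_vortexLaw_time (hθ : 0 < θ) {lam : ℝ} (hlam : 0 < lam) (N : Set.Ici (1 : ℝ)) :
    Tendsto (fun M : ℝ≥0 => vortexLaw hδ θ hlam (M : ℝ≥0∞) N) atTop
      (𝓝 (vortexLaw hδ θ hlam ∞ N)) := by
  have hN : (0 : ℝ) < N := zero_lt_one.trans_le N.2
  have := isProbabilityMeasure_sampleMeasure (mul_pos hN hlam)
  set c := (√(N : ℝ))⁻¹
  have hXm : ∀ M, Measurable fun z => c • vortexSum hδ θ M z := fun M =>
    (measurable_vortexSum hδ θ M).const_smul c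
  have hlaw : ∀ M, (vortexLaw hδ θ hlam M N : Measure (Sobolev (-1 - δ))) =
      (sampleMeasure (N * lam)).map fun z => c • vortexSum hδ θ M z := fun _ => rfl
  rw [ProbabilityMeasure.tendsto_iff_forall_integral_tendsto]
  intro f
  simp only [hlaw, integral_map (hXm _).aemeasurable f.continuous.aestronglyMeasurable]
  refine tendsto_integral_filter_of_dominated_convergence (fun _ => ‖f‖)
    (.of_forall fun M => (f.continuous.measurable.comp (hXm M)).aestronglyMeasurable)
    (.of_forall fun M => ae_of_all _ fun z => f.norm_coe_le_norm _) (integrable_const _) ?_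
  filter_upwards [ae_tendsto_vortexSum hδ hθ (mul_pos hN hlam)] with z hz
  exact (f.continuous.tendsto _).comp (hz.const_smul c)

end Time

/-! ### Convergence as the intensity tends to infinity -/

section Intensity

variable {θ δ : ℝ} (hδ : 0 < δ)

/-- The characteristic functional of a probability measure on `H^(-1-δ)`. -/
noncomputable def charFunctional (μ : ProbabilityMeasure (Sobolev (-1 - δ))) (h : Sobolev (1 + δ)) :
    ℂ := ∫ u, Complex.exp ((pairing u h : ℝ) * Complex.I) ∂(μ : Measure (Sobolev (-1 - δ)))

theorem continuous_charFunctional (h : Sobolev (1 + δ)) :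
    Continuous fun μ : ProbabilityMeasure (Sobolev (-1 - δ)) => charFunctional μ h := by
  have hL : Continuous fun p : Sobolev (-1 - δ) × Sobolev (1 + δ) =>
      pairingBilin (order_add_eq_zero δ) p.1 p.2 := continuous_pairing (order_add_eq_zero δ)
  rw [continuous_iff_continuousAt]
  intro μ
  exact (ProbabilityMeasure.tendsto_iff_forall_integral_rclike_tendsto ℂ).1 tendsto_id
    (BoundedContinuousFunction.char Real.continuous_probChar hL h)

theorem ext_of_charFunctional {μ ν : ProbabilityMeasure (Sobolev (-1 - δ))}
    (h : ∀ w, charFunctional μ w = charFunctional ν w) : μ = ν :=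
  Subtype.ext <| ext_of_integral_char_eq Real.continuous_probChar
    Real.probChar_ne_one (L := pairingBilin (order_add_eq_zero δ))
    (P := (μ : Measure (Sobolev (-1 - δ)))) (P' := (ν : Measure (Sobolev (-1 - δ))))
    (fun _ hv => pairingBilin_ne_zero (order_add_eq_zero δ) hv)
    (continuous_pairing (order_add_eq_zero δ)) h

theorem charFunctional_scaledLaw (c : ℝ) (μ : ProbabilityMeasure (Sobolev (-1 - δ)))
    (h : Sobolev (1 + δ)) : charFunctional (scaledLaw c μ) h = charFunctional μ (c • h) := by
  have hc := (continuous_pairing_left (order_add_eq_zero δ) h)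
  have hm : (scaledLaw c μ : Measure (Sobolev (-1 - δ))) =
      (μ : Measure (Sobolev (-1 - δ))).map fun u => c • u := rfl
  rw [charFunctional, hm, integral_map (measurable_const_smul c).aemeasurable
    (Continuous.aestronglyMeasurable (by fun_prop)), charFunctional]
  simp only [pairing_smul_left (order_add_eq_zero δ), pairing_smul_right (order_add_eq_zero δ)]

/-- The functional at `t • h` is the characteristic function at t of the coupling with `h`, so its
values at all `h` fix every one-dimensional law. -/
theorem isWhiteNoise_iff (η : ProbabilityMeasure (Sobolev (-1 - δ))) :
    IsWhiteNoise δ η ↔ ∀ h, charFunctional η h = Complex.exp (-(l2NormSq h / 2 : ℝ)) := by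
  have hc := fun h : Sobolev (1 + δ) => continuous_pairing_left (order_add_eq_zero δ) h
  have hmap : ∀ (h : Sobolev (1 + δ)) (t : ℝ),
      charFun ((η : Measure (Sobolev (-1 - δ))).map fun u => pairing u h) t =
        charFunctional η (t • h) := by
    intro h t
    rw [charFun_apply_real, integral_map (hc h).measurable.aemeasurable
      (Continuous.aestronglyMeasurable (by fun_prop)), charFunctional]
    simp only [pairing_smul_right (order_add_eq_zero δ)]
    push_cast
    rfl
  constructor
  · intro hη h
    have := hmap h 1
    rw [(hη h).map_eq, charFun_gaussianReal, one_smul] at this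
    rw [← this, Real.coe_toNNReal _ (l2NormSq_nonneg h)]
    congr 1
    push_cast
    ring
  · intro hη h
    refine ⟨(hc h).measurable.aemeasurable, ?_⟩
    have := Measure.isProbabilityMeasure_map (μ := (η : Measure (Sobolev (-1 - δ))))
      (hc h).measurable.aemeasurable
    refine Measure.ext_of_charFun (funext fun t => ?_)
    rw [hmap, hη, charFun_gaussianReal, l2NormSq_smul, Real.coe_toNNReal _ (l2NormSq_nonneg h)]
    congr 1
    push_cast
    ring

theorem charFunctional_scaledLaw_of_isWhiteNoise {η : ProbabilityMeasure (Sobolev (-1 - δ))}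
    (hη : IsWhiteNoise δ η) {v : ℝ} (hv : 0 ≤ v) (h : Sobolev (1 + δ)) :
    charFunctional (scaledLaw (√v) η) h = Complex.exp (-(v * l2NormSq h / 2 : ℝ)) := by
  rw [charFunctional_scaledLaw, (isWhiteNoise_iff η).1 hη, l2NormSq_smul, Real.sq_sqrt hv]

theorem limitVariance_nonneg (hθ : 0 < θ) {lam : ℝ} (hlam : 0 < lam) (M : ℝ≥0∞) :
    0 ≤ limitVariance θ lam M := by
  rw [limitVariance, mul_div_assoc]
  refine mul_nonneg (sub_nonneg.2 ?_) (by positivity)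
  split_ifs
  · exact zero_le_one
  · rw [Real.exp_le_one_iff]
    have := mul_nonneg hθ.le (ENNReal.toReal_nonneg (a := M))
    linarith

theorem tendsto_charFunctional_vortexLaw (hθ : 0 < θ) {lam : ℝ} (hlam : 0 < lam) (M : ℝ≥0∞)
    (h : Sobolev (1 + δ)) :
    Tendsto (fun N => charFunctional (vortexLaw hδ θ hlam M N) h) atTop
      (𝓝 (Complex.exp (-(limitVariance θ lam M * l2NormSq h / 2 : ℝ)))) := by
  have h1 := (Complex.continuous_ofReal.tendsto _).comp (tendsto_expTail_meanCos hδ hθ lam M h)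
  rw [← tendsto_comp_val_Ici_atTop (a := (1 : ℝ))] at h1
  rw [← Complex.ofReal_neg, ← Complex.ofReal_exp]
  refine h1.congr fun N => ?_
  have hN : (0 : ℝ) < N := zero_lt_one.trans_le N.2
  have hc := continuous_pairing_left (order_add_eq_zero δ) h
  have hXm : Measurable fun z => (√(N : ℝ))⁻¹ • vortexSum hδ θ M z :=
    (measurable_vortexSum hδ θ M).const_smul (√(N : ℝ))⁻¹
  have hlaw : (vortexLaw hδ θ hlam M N : Measure (Sobolev (-1 - δ))) =
      (sampleMeasure (N * lam)).map fun z => (√(N : ℝ))⁻¹ • vortexSum hδ θ M z := rfl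
  rw [charFunctional, hlaw, integral_map hXm.aemeasurable
    (Continuous.aestronglyMeasurable (by fun_prop)),
    integral_cexp_pairing_vortexSum hδ hθ (mul_pos hN hlam)]
  rfl

theorem charFunctional_of_mapClusterPt (hθ : 0 < θ) {lam : ℝ} (hlam : 0 < lam) (M : ℝ≥0∞)
    {μ : ProbabilityMeasure (Sobolev (-1 - δ))}
    (hμ : MapClusterPt μ atTop fun N => vortexLaw hδ θ hlam M N) (h : Sobolev (1 + δ)) :
    charFunctional μ h = Complex.exp (-(limitVariance θ lam M * l2NormSq h / 2 : ℝ)) := by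
  have h1 := hμ.continuousAt_comp (continuous_charFunctional h).continuousAt
  exact eq_of_nhds_neBot
    (h1.clusterPt.mono (tendsto_charFunctional_vortexLaw hδ hθ hlam M h))

theorem isCompact_closure_range_vortexLaw (hθ : 0 < θ) {lam : ℝ} (hlam : 0 < lam) (M : ℝ≥0∞) :
    IsCompact (closure (Set.range fun N => vortexLaw hδ θ hlam M N)) := by
  refine isCompact_closure_of_isTightMeasureSet
    ((isTightMeasureSet_vortexLaw hδ hθ hlam).subset ?_)
  rintro _ ⟨_, ⟨N, rfl⟩, rfl⟩
  exact ⟨M, N, rfl⟩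

theorem exists_isWhiteNoise {δ : ℝ} (hδ : 0 < δ) : ∃ η, IsWhiteNoise δ η := by
  -- For θ = λ = 1 and M = ∞ the limit variance is 1/2, hence the factor √2 below.
  obtain ⟨μ, -, hμ⟩ := (isCompact_closure_range_vortexLaw hδ one_pos one_pos ∞).exists_mapClusterPt
    (f := atTop) (u := fun N => vortexLaw hδ 1 one_pos ∞ N)
    (tendsto_principal.2 (.of_forall fun N => subset_closure ⟨N, rfl⟩))
  refine ⟨scaledLaw (√2) μ, (isWhiteNoise_iff _).2 fun h => ?_⟩
  rw [charFunctional_scaledLaw, charFunctional_of_mapClusterPt hδ one_pos one_pos ∞ hμ,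
    l2NormSq_smul, Real.sq_sqrt zero_le_two, limitVariance, if_pos rfl]
  congr 3
  ring

/-- In a compact set, a family with only one possible cluster point converges to it. -/
theorem tendsto_vortexLaw_intensity (hθ : 0 < θ) {lam : ℝ} (hlam : 0 < lam)
    {η : ProbabilityMeasure (Sobolev (-1 - δ))} (hη : IsWhiteNoise δ η) (M : ℝ≥0∞) :
    Tendsto (fun N => vortexLaw hδ θ hlam M N) atTop
      (𝓝 (scaledLaw (√(limitVariance θ lam M)) η)) := by
  refine (isCompact_closure_range_vortexLaw hδ hθ hlam M).tendsto_nhds_of_unique_mapClusterPt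
    (.of_forall fun N => subset_closure ⟨N, rfl⟩) fun μ _ hμ => ext_of_charFunctional fun h => ?_
  rw [charFunctional_of_mapClusterPt hδ hθ hlam M hμ,
    charFunctional_scaledLaw_of_isWhiteNoise hη (limitVariance_nonneg hθ hlam M)]

end Intensity

/-! ### Moments and convergence in `L^p` -/

/-- Pass to the integer power ⌈r⌉ and use x^n / n! ≤ exp x ≤ 2 cosh x. -/
theorem exists_rpow_le_mul_cosh {r : ℝ} (hr0 : 0 ≤ r) :
    ∃ C : ℝ, 0 ≤ C ∧ ∀ x, 0 ≤ x → x ^ r ≤ C * Real.cosh x := by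
  set n := ⌈r⌉₊
  refine ⟨1 + 2 * n.factorial, by positivity, fun x hx => ?_⟩
  have hcosh := Real.one_le_cosh x
  have hexp : Real.exp x ≤ 2 * Real.cosh x := by
    rw [Real.cosh_eq]
    linarith [Real.exp_pos (-x)]
  have hpow : x ^ n ≤ 2 * n.factorial * Real.cosh x := by
    have h := Real.pow_div_factorial_le_exp x hx n
    rw [div_le_iff₀ (by positivity)] at h
    calc x ^ n ≤ Real.exp x * n.factorial := h
      _ ≤ 2 * Real.cosh x * n.factorial := by gcongr
      _ = _ := by ring
  have hr : x ^ r ≤ 1 + x ^ n := by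
    rcases le_total x 1 with h1 | h1
    · have := Real.rpow_le_one hx h1 hr0
      linarith [pow_nonneg hx n]
    · have := Real.rpow_le_rpow_of_exponent_le h1 (Nat.le_ceil r)
      rw [Real.rpow_natCast] at this
      linarith
  linarith

section Moments

/-- A family of functions which is bounded in `L^(2p)` is uniformly integrable in `L^p`. -/
theorem unifIntegrable_of_lintegral_le {Ω ι E : Type*} [MeasurableSpace Ω] {P : Measure Ω}
    [NormedAddCommGroup E] {p : ℝ≥0∞} (hp : 1 ≤ p) (hp' : p ≠ ∞) {f : ι → Ω → E}
    (hf : ∀ i, AEStronglyMeasurable (f i) P) {B : ℝ≥0∞} (hB : B ≠ ∞)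
    (h : ∀ i, ∫⁻ ω, ‖f i ω‖ₑ ^ (2 * p.toReal) ∂P ≤ B) : UnifIntegrable f p P := by
  have hp0 : p ≠ 0 := (zero_lt_one.trans_le hp).ne'
  have hpr : 0 < p.toReal := ENNReal.toReal_pos hp0 hp'
  refine unifIntegrable_of hp hp' hf fun ε hε => ?_
  set A : ℝ≥0∞ := B ^ (1 / p.toReal) with hA
  have hAt : A ≠ ∞ := ENNReal.rpow_ne_top_of_nonneg (by positivity) hB
  -- On the set where |f| ≥ C one has |f| ≤ |f|²/C, so the truncated norm is at most A/C. This `C`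
  -- makes it at most ε; the added 1 keeps `C` nonzero.
  set C : ℝ≥0 := A.toNNReal / ε.toNNReal + 1 with hC
  have hC0 : (C : ℝ≥0∞) ≠ 0 := by
    rw [hC]
    simp
  refine ⟨C, fun i => ?_⟩
  have hpt : ∀ ω, ‖({x | C ≤ ‖f i x‖₊}.indicator (f i)) ω‖ₑ ^ p.toReal ≤
      ((C : ℝ≥0∞)⁻¹) ^ p.toReal * ‖f i ω‖ₑ ^ (2 * p.toReal) := by
    intro ω
    by_cases hω : C ≤ ‖f i ω‖₊
    · rw [Set.indicator_of_mem (show ω ∈ {x | C ≤ ‖f i x‖₊} from hω), ENNReal.rpow_mul,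
        ← ENNReal.mul_rpow_of_nonneg _ _ hpr.le]
      refine ENNReal.rpow_le_rpow ?_ hpr.le
      have hω' : (C : ℝ≥0∞) ≤ ‖f i ω‖ₑ := ENNReal.coe_le_coe.2 hω
      calc ‖f i ω‖ₑ = (C : ℝ≥0∞)⁻¹ * C * ‖f i ω‖ₑ := by
            rw [ENNReal.inv_mul_cancel hC0 ENNReal.coe_ne_top, one_mul]
        _ ≤ (C : ℝ≥0∞)⁻¹ * ‖f i ω‖ₑ * ‖f i ω‖ₑ := by gcongr
        _ = (C : ℝ≥0∞)⁻¹ * ‖f i ω‖ₑ ^ (2 : ℝ) := by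
            rw [ENNReal.rpow_two, sq, mul_assoc]
    · rw [Set.indicator_of_notMem (show ω ∉ {x | C ≤ ‖f i x‖₊} from hω), enorm_zero,
        ENNReal.zero_rpow_of_pos hpr]
      exact zero_le
  rw [eLpNorm_eq_lintegral_rpow_enorm_toReal hp0 hp']
  calc _ ≤ (((C : ℝ≥0∞)⁻¹) ^ p.toReal * B) ^ (1 / p.toReal) := by
        refine ENNReal.rpow_le_rpow ((lintegral_mono hpt).trans ?_) (by positivity)
        rw [lintegral_const_mul' _ _ (ENNReal.rpow_ne_top_of_nonneg hpr.le
          (ENNReal.inv_ne_top.2 hC0))]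
        gcongr
        exact h i
    _ = (C : ℝ≥0∞)⁻¹ * A := by
        rw [ENNReal.mul_rpow_of_nonneg _ _ (by positivity), ← ENNReal.rpow_mul,
          mul_one_div_cancel hpr.ne', ENNReal.rpow_one]
    _ ≤ ENNReal.ofReal ε := by
        rw [mul_comm, ← div_eq_mul_inv]
        refine ENNReal.div_le_of_le_mul ?_
        rw [← ENNReal.coe_toNNReal hAt, ENNReal.ofReal, ← ENNReal.coe_mul, ENNReal.coe_le_coe, hC,
          mul_add, mul_div_cancel₀ _ (Real.toNNReal_pos.2 hε).ne']
        exact le_self_add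

variable {θ δ : ℝ} (hδ : 0 < δ)

theorem exists_lintegral_rpow_vortexLaw_le (hθ : 0 < θ) {lam : ℝ} (hlam : 0 < lam) (r : ℝ)
    (hr : 0 ≤ r) :
    ∃ B : ℝ≥0∞, B ≠ ∞ ∧ ∀ (M : ℝ≥0∞) (N : Set.Ici (1 : ℝ)),
      ∫⁻ u, ‖u‖ₑ ^ r ∂(vortexLaw hδ θ hlam M N : Measure (Sobolev (-1 - δ))) ≤ B := by
  obtain ⟨C, hC, hle⟩ := exists_rpow_le_mul_cosh hr
  refine ⟨ENNReal.ofReal C * ENNReal.ofReal (momentBound θ lam δ),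
    ENNReal.mul_ne_top ENNReal.ofReal_ne_top ENNReal.ofReal_ne_top, fun M N => ?_⟩
  calc _ ≤ ∫⁻ u, ENNReal.ofReal C * ENNReal.ofReal (Real.cosh ‖u‖)
        ∂(vortexLaw hδ θ hlam M N : Measure (Sobolev (-1 - δ))) := by
        refine lintegral_mono fun u => ?_
        rw [← ofReal_norm, ENNReal.ofReal_rpow_of_nonneg (norm_nonneg u) hr,
          ← ENNReal.ofReal_mul hC]
        exact ENNReal.ofReal_le_ofReal (hle _ (norm_nonneg u))
    _ ≤ _ := by
        rw [lintegral_const_mul' _ _ ENNReal.ofReal_ne_top]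
        gcongr
        exact lintegral_cosh_vortexLaw_le hδ hθ hlam M N

theorem tendsto_eLpNorm_of_hasLaw (hθ : 0 < θ) {lam : ℝ} (hlam : 0 < lam)
    {Ω : Type*} [MeasurableSpace Ω] (P : Measure Ω) [IsProbabilityMeasure P]
    {ι : Type*} (l : Filter ι) [l.NeBot] [l.IsCountablyGenerated]
    (M : ι → ℝ≥0∞) (N : ι → Set.Ici (1 : ℝ))
    (X : ι → Ω → Sobolev (-1 - δ)) (Y : Ω → Sobolev (-1 - δ))
    (hX : ∀ i, HasLaw (X i) (vortexLaw hδ θ hlam (M i) (N i) : Measure (Sobolev (-1 - δ))) P)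
    (hXY : ∀ᵐ ω ∂P, Tendsto (fun i => X i ω) l (𝓝 (Y ω)))
    (p : ℝ≥0∞) (hp : 1 ≤ p) (hp' : p ≠ ∞) :
    (∀ i, MemLp (X i) p P) ∧ MemLp Y p P ∧
      Tendsto (fun i => eLpNorm (fun ω => X i ω - Y ω) p P) l (𝓝 0) := by
  have hp0 : p ≠ 0 := (zero_lt_one.trans_le hp).ne'
  have hpr : 0 < p.toReal := ENNReal.toReal_pos hp0 hp'
  have hmeas : ∀ i, AEStronglyMeasurable (X i) P := fun i => (hX i).aemeasurable.aestronglyMeasurable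
  have hmom : ∀ r : ℝ, 0 ≤ r → ∃ B : ℝ≥0∞, B ≠ ∞ ∧ ∀ i, ∫⁻ ω, ‖X i ω‖ₑ ^ r ∂P ≤ B := by
    intro r hr
    obtain ⟨B, hB, hle⟩ := exists_lintegral_rpow_vortexLaw_le hδ hθ hlam r hr
    refine ⟨B, hB, fun i => ?_⟩
    have hm : Measurable fun u : Sobolev (-1 - δ) => ‖u‖ₑ ^ r := by fun_prop
    rw [(hX i).lintegral_comp hm.aemeasurable]
    exact hle _ _
  obtain ⟨B, hB, hle⟩ := hmom p.toReal hpr.le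
  obtain ⟨B', hB', hle'⟩ := hmom (2 * p.toReal) (by positivity)
  have hnorm : ∀ i, eLpNorm (X i) p P ≤ B ^ (1 / p.toReal) := by
    intro i
    rw [eLpNorm_eq_lintegral_rpow_enorm_toReal hp0 hp']
    exact ENNReal.rpow_le_rpow (hle i) (by positivity)
  have hBt : B ^ (1 / p.toReal) < ∞ := (ENNReal.rpow_ne_top_of_nonneg (by positivity) hB).lt_top
  have hui := unifIntegrable_of_lintegral_le hp hp' hmeas hB' hle'
  -- Measurability and the norm bound need a sequence along the filter; the bound is then Fatou's
  -- lemma.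
  have hY : MemLp Y p P := by
    obtain ⟨x, hx⟩ := l.exists_seq_tendsto
    have hxY : ∀ᵐ ω ∂P, Tendsto (fun n => X (x n) ω) atTop (𝓝 (Y ω)) := by
      filter_upwards [hXY] with ω hω using hω.comp hx
    refine ⟨aestronglyMeasurable_of_tendsto_ae atTop (fun n => hmeas (x n)) hxY, ?_⟩
    refine (Lp.eLpNorm_lim_le_liminf_eLpNorm (fun n => hmeas (x n)) Y hxY).trans_lt
      (lt_of_le_of_lt ?_ hBt)
    exact liminf_le_of_le (by isBoundedDefault) fun b hb =>
      hb.exists.elim fun n hn => hn.trans (hnorm _)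
  -- Countable generation lets convergence be tested on sequences, where Vitali's theorem applies.
  refine ⟨fun i => ⟨hmeas i, (hnorm i).trans_lt hBt⟩, hY, tendsto_of_seq_tendsto fun x hx => ?_⟩
  refine tendsto_Lp_finite_of_tendsto_ae hp hp' (fun n => hmeas (x n)) hY (fun ε hε => ?_) ?_
  · obtain ⟨η, hη, hs⟩ := hui hε
    exact ⟨η, hη, fun n s => hs (x n) s⟩
  · filter_upwards [hXY] with ω hω using hω.comp hx

end Moments

end TorusVortex

theorem proposition7 (θ lam δ : ℝ) (hθ : 0 < θ) (hlam : 0 < lam) (hδ : 0 < δ) :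
    -- tightness of the laws
    IsTightMeasureSet {μ : Measure (Sobolev (-1 - δ)) |
      ∃ (M : ℝ≥0∞) (N : Set.Ici (1 : ℝ)), μ = vortexLaw hδ θ hlam M N} ∧
    -- the limit in law as `M → ∞` at fixed `N`
    (∀ N : Set.Ici (1 : ℝ),
      Tendsto (fun M : ℝ≥0 => vortexLaw hδ θ hlam (M : ℝ≥0∞) N) atTop
        (𝓝 (vortexLaw hδ θ hlam ∞ N))) ∧
    -- the limit in law as `N → ∞` at fixed `M`
    (∃ η, IsWhiteNoise δ η) ∧
    (∀ η, IsWhiteNoise δ η → ∀ M : ℝ≥0∞,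
      Tendsto (fun N : Set.Ici (1 : ℝ) => vortexLaw hδ θ hlam M N) atTop
        (𝓝 (scaledLaw (√(limitVariance θ lam M)) η))) ∧
    -- almost sure convergence improves to convergence in `L^p`
    (∀ {Ω : Type*} [MeasurableSpace Ω] (P : Measure Ω) [IsProbabilityMeasure P]
      {ι : Type*} (l : Filter ι) [l.NeBot] [l.IsCountablyGenerated]
      (M : ι → ℝ≥0∞) (N : ι → Set.Ici (1 : ℝ))
      (X : ι → Ω → Sobolev (-1 - δ)) (Y : Ω → Sobolev (-1 - δ)),
      (∀ i, HasLaw (X i) (vortexLaw hδ θ hlam (M i) (N i) : Measure (Sobolev (-1 - δ))) P) →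
      (∀ᵐ ω ∂P, Tendsto (fun i => X i ω) l (𝓝 (Y ω))) →
      ∀ p : ℝ≥0∞, 1 ≤ p → p ≠ ∞ →
        (∀ i, MemLp (X i) p P) ∧ MemLp Y p P ∧
          Tendsto (fun i => eLpNorm (fun ω => X i ω - Y ω) p P) l (𝓝 0)) :=
  ⟨isTightMeasureSet_vortexLaw hδ hθ hlam, tendsto_vortexLaw_time hδ hθ hlam,
    exists_isWhiteNoise hδ, fun _ hη M => tendsto_vortexLaw_intensity hδ hθ hlam hη M,
    tendsto_eLpNorm_of_hasLaw hδ hθ hlam⟩
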